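/- **Setting.** Let $\mathcal G$ be a finite connected simple graph with vertex set $\mathcal V=\mathcal V_G\sqcup\mathcal V_L$, where the $N_G\ge 1$ vertices of $\mathcal V_G$ (the first ones in the numbering) are generator buses and the $N_L\ge 1$ vertices of $\mathcal V_L$ are load buses, $N=N_G+N_L$, and with edge set $\mathcal E$, $|\mathcal E|=E$. Let $C\in\mathbb R^{N\times E}$ be an oriented incidence matrix, $B=\mathrm{diag}(b_1,\dots,b_E)$ with all $b_e>0$, and $L=CBC^{\mathsf T}$. For a cost vector $f\in\mathbb R_{\ge0}^{N_G}$, limits $\xi=(\overline s^g,\underline s^g,\overline p,\underline p)\in\mathbb R^{2N_G+2E}$ and a load vector $s^l\in\mathbb R^{N_L}$ consider the linear program $$\min_{s^g,\theta} f^{\mathsf T}s^g\quad\text{s.t.}\quad \theta_1=0,\quad L\theta=\begin{bmatrix}s^g\\-s^l\end{bmatrix},\quad \underline s^g\le s^g\le\overline s^g,\quad \underline p\le BC^{\mathsf T}\theta\le\overline p. \qquad(\mathrm{OPF})$$ Let $\Omega_\xi$ be the set of $\xi$ with $\underline s^g\ge0$ for which (OPF) is feasible for some $s^l>0$; let $\Omega_{s^l}(\xi)$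 be the set of $s^l>0$ for which (OPF) is feasible; let $\Omega_f$ be the set of $f\ge0$ such that for all $\xi\in\Omega_\xi$ and $s^l\in\Omega_{s^l}(\xi)$, (OPF) has a unique solution $(s^g,\theta)$ and, at this solution, every vector of KKT multipliers has at least $N_G-1$ nonzero entries belonging to inequality constraints. Let $\widetilde\Omega_{s^l}(\xi,f)$ be the set of $s^l\in\Omega_{s^l}(\xi)$ for which exactly $N_G-1$ of the $2N_G+2E$ inequalities of (OPF) are binding at the optimum. For $f\in\Omega_f$ let $R_\xi(f)$ be the set of $\xi\in\Omega_\xi$ such that $\mathrm{clos}(\mathrm{int}\,\Omega_{s^l}(\xi))=\mathrm{clos}(\Omega_{s^l}(\xi))$ and $\widetilde\Omega_{s^l}(\xi,f)$ is dense in $\Omega_{s^l}(\xi)$, and let $\widetilde\Omega_\xi(f)$ be $R_\xi(f)$ or, more generally, any dense subset of $R_\xi(f)$. For $f\in\Omega_f$, $\xi\in\widetilde\Omega_\xi(f)$ let $\mathcal{OPF}(s^l)$ be the generation part of the solution of (OPF), and $J(s^l;f,\xi):=\partial\,\mathcal{OPF}(s^l)/\partial s^l\in\mathbb R^{N_G\times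 N_L}$. For $S_G\subseteq\mathcal V_G$ and $S_B\subseteq\mathcal E$ write $S_G\perp S_B$ if the rows of the constraint matrix of (OPF), in the variables $(s^g,\theta)$, that belong to the limits of the generators in $S_G$ and of the branches in $S_B$ (one row each), along with the rows of the $N+1$ equality constraints, are linearly independent. Call $(S_G,S_B)$ admissible if $|S_G|+|S_B|=N_G-1$ and $S_G\perp S_B$, and then put, with $Y_{\mathcal I}$ the submatrix of the rows of $Y$ indexed by $\mathcal I$, $$Z(S_G,S_B)^{\mathsf T}=\begin{bmatrix} L_{\mathcal V_L}\\ L_{S_G}\\ (BC^{\mathsf T})_{S_B}\\ e_1^{\mathsf T}\end{bmatrix}^{-1},\qquad J(S_G,S_B)=-\bigl(L_{\mathcal V_G}\,Z(S_G,S_B)^{\mathsf T}\bigr)_{\text{first }N_L\text{ columns}} .$$ **Theorem.** 1. $$\bigl\{J(s^l;f,\xi): f\in\Omega_f,\ \xi\in\widetilde\Omega_\xi(f),\ s^l\in\widetilde\Omega_{s^l}(\xi,f)\bigr\}=\bigl\{J(S_G,S_B): (S_G,S_B)\text{ admissible}\bigr\}.$$ 2. If $f\in\Omega_f$, $\xi\in\widetilde\Omega_\xi(f)$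 and $s^l\in\widetilde\Omega_{s^l}(\xi,f)$, then $\mathcal{OPF}$ is differentiable at $s^l$, the sets $S_G$ and $S_B$ of generators and of branches with a binding limit at the optimum form an admissible pair, and $J(s^l;f,\xi)=J(S_G,S_B)$. 3. For every admissible pair $(S_G,S_B)$ the inverse above exists, and there are $f\in\Omega_f$, $\xi\in\widetilde\Omega_\xi(f)$ and $s^l\in\widetilde\Omega_{s^l}(\xi,f)$ for which $S_G$ and $S_B$ are exactly the sets of generators and of branches with a binding limit at the optimum. -/

import Mathlib

open scoped Matrix

namespace DCOPF

/-- The buses: `Sum.inl i` is generator bus `i`, `Sum.inr j` is load bus `j`. -/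
abbrev Bus (nG nL : ℕ) : Type := Fin nG ⊕ Fin nL

/-- A power network with `nG` generator buses, `nL` load buses and `nE` branches: a connected
simple graph on the buses whose edges are listed exactly once, each with an arbitrarily chosen
orientation `tail e → head e`, together with positive branch susceptances. -/
structure Network (nG nL nE : ℕ) where
  graph : SimpleGraph (Bus nG nL)
  connected : graph.Connected
  tail : Fin nE → Bus nG nL
  head : Fin nE → Bus nG nL
  edges : Set.BijOn (fun e => s(tail e, head e)) Set.univ graph.edgeSet
  susceptance : Fin nE → ℝ
  susceptance_pos : ∀ e, 0 < susceptance e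

/-- The vector `ξ = (s̄ᵍ, s̲ᵍ, p̄, p̲)` of network limits. -/
abbrev Limits (nG nE : ℕ) : Type :=
  (Fin nG → ℝ) × (Fin nG → ℝ) × (Fin nE → ℝ) × (Fin nE → ℝ)

section LimitComponents
variable {nG nE : ℕ}

/-- Upper generation limits. -/
def sMax (ξ : Limits nG nE) : Fin nG → ℝ := ξ.1
/-- Lower generation limits. -/
def sMin (ξ : Limits nG nE) : Fin nG → ℝ := ξ.2.1
/-- Upper branch flow limits. -/
def pMax (ξ : Limits nG nE) : Fin nE → ℝ := ξ.2.2.1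
/-- Lower branch flow limits. -/
def pMin (ξ : Limits nG nE) : Fin nE → ℝ := ξ.2.2.2

end LimitComponents

/-- Lagrange multipliers: `τ` (nodal balance), `τ₀` (slack bus angle), `lamU`, `lamL` (upper and
lower generation limits), `muU`, `muL` (upper and lower flow limits). -/
structure Multipliers (nG nL nE : ℕ) where
  τ : Bus nG nL → ℝ
  τ₀ : ℝ
  lamU : Fin nG → ℝ
  lamL : Fin nG → ℝ
  muU : Fin nE → ℝ
  muL : Fin nE → ℝ

/-- The number of nonzero multipliers of the inequality constraints. -/
noncomputable def Multipliers.nonzeroCount {nG nL nE : ℕ} (m : Multipliers nG nL nE) : ℕ :=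
  (Finset.univ.filter fun i => m.lamU i ≠ 0).card + (Finset.univ.filter fun i => m.lamL i ≠ 0).card
    + (Finset.univ.filter fun e => m.muU e ≠ 0).card
    + (Finset.univ.filter fun e => m.muL e ≠ 0).card

namespace Network

variable {nG nL nE : ℕ} (net : Network nG nL nE)

/-- The oriented incidence matrix `C`. -/
def incidence : Matrix (Bus nG nL) (Fin nE) ℝ :=
  Matrix.of fun v e => if v = net.tail e then 1 else if v = net.head e then -1 else 0

/-- The weighted Laplacian `L = C B Cᵀ`. -/
def laplacian : Matrix (Bus nG nL) (Bus nG nL) ℝ :=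
  net.incidence * Matrix.diagonal net.susceptance * net.incidenceᵀ

/-- The matrix `B Cᵀ` sending voltage angles to branch flows. -/
def flowMatrix : Matrix (Fin nE) (Bus nG nL) ℝ :=
  Matrix.diagonal net.susceptance * net.incidenceᵀ

variable [NeZero nG]

/-- The slack bus: the first generator bus. -/
def slack (_net : Network nG nL nE) : Bus nG nL := Sum.inl 0

/-! ### The DC optimal power flow problem -/

/-- `(s, θ)` satisfies the constraints of the DC-OPF problem with limits `ξ` and load `l`. -/
structure Feasible (ξ : Limits nG nE) (l : Fin nL → ℝ) (s : Fin nG → ℝ) (θ : Bus nG nL → ℝ) :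
    Prop where
  slack_eq : θ net.slack = 0
  balance : net.laplacian *ᵥ θ = Sum.elim s (-l)
  gen_lower : ∀ i, sMin ξ i ≤ s i
  gen_upper : ∀ i, s i ≤ sMax ξ i
  flow_lower : ∀ e, pMin ξ e ≤ (net.flowMatrix *ᵥ θ) e
  flow_upper : ∀ e, (net.flowMatrix *ᵥ θ) e ≤ pMax ξ e

/-- `(s, θ)` is an optimal solution of the DC-OPF problem with cost vector `f`. -/
def IsOptimal (f : Fin nG → ℝ) (ξ : Limits nG nE) (l : Fin nL → ℝ) (s : Fin nG → ℝ)
    (θ : Bus nG nL → ℝ) : Prop :=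
  net.Feasible ξ l s θ ∧ ∀ s' θ', net.Feasible ξ l s' θ' → f ⬝ᵥ s ≤ f ⬝ᵥ s'

/-- The KKT conditions of the DC-OPF problem. -/
structure IsKKT (f : Fin nG → ℝ) (ξ : Limits nG nE) (l : Fin nL → ℝ) (s : Fin nG → ℝ)
    (θ : Bus nG nL → ℝ) (m : Multipliers nG nL nE) : Prop where
  feasible : net.Feasible ξ l s θ
  stationary_angle :
    net.laplacianᵀ *ᵥ m.τ + Pi.single net.slack m.τ₀
      + (net.incidence * Matrix.diagonal net.susceptance) *ᵥ (m.muU - m.muL) = 0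
  stationary_gen : ∀ i, -f i = -m.τ (Sum.inl i) + m.lamU i - m.lamL i
  lamU_nonneg : ∀ i, 0 ≤ m.lamU i
  lamL_nonneg : ∀ i, 0 ≤ m.lamL i
  muU_nonneg : ∀ e, 0 ≤ m.muU e
  muL_nonneg : ∀ e, 0 ≤ m.muL e
  compl_lamU : m.lamU ⬝ᵥ (s - sMax ξ) = 0
  compl_lamL : m.lamL ⬝ᵥ (sMin ξ - s) = 0
  compl_muU : m.muU ⬝ᵥ (net.flowMatrix *ᵥ θ - pMax ξ) = 0
  compl_muL : m.muL ⬝ᵥ (pMin ξ - net.flowMatrix *ᵥ θ) = 0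

/-! ### Binding constraints -/

/-- The number of binding inequalities at `(s, θ)`, among all `2 nG + 2 nE` inequalities. -/
noncomputable def bindingCount (ξ : Limits nG nE) (s : Fin nG → ℝ) (θ : Bus nG nL → ℝ) : ℕ :=
  (Finset.univ.filter fun i => s i = sMax ξ i).card
    + (Finset.univ.filter fun i => s i = sMin ξ i).card
    + (Finset.univ.filter fun e => (net.flowMatrix *ᵥ θ) e = pMax ξ e).card
    + (Finset.univ.filter fun e => (net.flowMatrix *ᵥ θ) e = pMin ξ e).card

/-- The generators with a binding limit. -/
noncomputable def bindingGens (_net : Network nG nL nE) (ξ : Limits nG nE) (s : Fin nG → ℝ) :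
    Finset (Fin nG) :=
  Finset.univ.filter fun i => s i = sMax ξ i ∨ s i = sMin ξ i

/-- The branches with a binding flow limit. -/
noncomputable def bindingBranches (ξ : Limits nG nE) (θ : Bus nG nL → ℝ) : Finset (Fin nE) :=
  Finset.univ.filter fun e =>
    (net.flowMatrix *ᵥ θ) e = pMax ξ e ∨ (net.flowMatrix *ᵥ θ) e = pMin ξ e

/-! ### Parameter sets -/

/-- `Ω_ξ`: limits with `s̲ᵍ ≥ 0` that are feasible for some positive load. -/
def limitSet : Set (Limits nG nE) :=
  {ξ | (∀ i, 0 ≤ sMin ξ i) ∧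
    ∃ l : Fin nL → ℝ, (∀ j, 0 < l j) ∧ ∃ s θ, net.Feasible ξ l s θ}

/-- `Ω_{sˡ}(ξ)`: the positive loads for which the problem is feasible. -/
def loadSet (ξ : Limits nG nE) : Set (Fin nL → ℝ) :=
  {l | (∀ j, 0 < l j) ∧ ∃ s θ, net.Feasible ξ l s θ}

/-- `Ω_f`: nonnegative costs for which, whatever the limits and loads, the problem has a unique
solution, and at it every vector of KKT multipliers has at least `nG - 1` nonzero entries for the
inequality constraints. -/
def costSet : Set (Fin nG → ℝ) :=
  {f | (∀ i, 0 ≤ f i) ∧ ∀ ξ ∈ net.limitSet, ∀ l ∈ net.loadSet ξ,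
    (∃! x : (Fin nG → ℝ) × (Bus nG nL → ℝ), net.IsOptimal f ξ l x.1 x.2) ∧
    ∀ s θ, net.IsOptimal f ξ l s θ → ∀ m, net.IsKKT f ξ l s θ m → nG ≤ m.nonzeroCount + 1}

/-- `Ω̃_{sˡ}(ξ, f)`: loads for which exactly `nG - 1` inequalities are binding at the optimum. -/
def genericLoads (ξ : Limits nG nE) (f : Fin nG → ℝ) : Set (Fin nL → ℝ) :=
  {l | l ∈ net.loadSet ξ ∧
    ∃ s θ, net.IsOptimal f ξ l s θ ∧ net.bindingCount ξ s θ + 1 = nG}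

/-- The limits `ξ ∈ Ω_ξ` for which the closure of the interior of `Ω_{sˡ}(ξ)` is the closure of
`Ω_{sˡ}(ξ)` and `Ω̃_{sˡ}(ξ, f)` is dense in `Ω_{sˡ}(ξ)`. -/
def regularLimits (f : Fin nG → ℝ) : Set (Limits nG nE) :=
  {ξ | ξ ∈ net.limitSet ∧ closure (interior (net.loadSet ξ)) = closure (net.loadSet ξ) ∧
    net.loadSet ξ ⊆ closure (net.genericLoads ξ f)}

/-! ### The OPF operator and its Jacobian -/

open Classical in
/-- The OPF operator: it maps a load to the generation part of an optimal solution (and takes the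
arbitrary value `0` where there is none). -/
noncomputable def opf (f : Fin nG → ℝ) (ξ : Limits nG nE) (l : Fin nL → ℝ) : Fin nG → ℝ :=
  if h : ∃ s θ, net.IsOptimal f ξ l s θ then h.choose else 0

/-- The matrix of partial derivatives of the OPF operator with respect to the loads, at `l`. -/
noncomputable def jacobian (f : Fin nG → ℝ) (ξ : Limits nG nE) (l : Fin nL → ℝ) :
    Matrix (Fin nG) (Fin nL) ℝ :=
  Matrix.of fun i j => deriv (fun t => net.opf f ξ (Function.update l j t) i) (l j)

/-! ### Binding sets and their Jacobian -/

/-- The rows of the equality constraints `θ_slack = 0` and `L θ - W sᵍ = (0, -sˡ)`, where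
`W = [I; 0]`, in the variables `(sᵍ, θ)`. -/
def equalityRows : Matrix (Unit ⊕ Bus nG nL) (Fin nG ⊕ Bus nG nL) ℝ :=
  Matrix.fromBlocks 0 (Matrix.of fun _ => Pi.single net.slack 1)
    (-Matrix.fromRows 1 0) net.laplacian

/-- The rows `[I 0]` of the generation limits and `[0 BCᵀ]` of the flow limits, in the variables
`(sᵍ, θ)`. The constraint matrix of the problem in the standard form `A x ≤ b` consists of the
rows of `equalityRows` and `inequalityRows` and of their negatives. -/
def inequalityRows : Matrix (Fin nG ⊕ Fin nE) (Fin nG ⊕ Bus nG nL) ℝ :=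
  Matrix.fromBlocks 1 0 0 net.flowMatrix

/-- `S_G ⊥ S_B`: the inequality constraints in `S_G` and `S_B`, along with the equality
constraints, have linearly independent rows. -/
def Independent (SG : Finset (Fin nG)) (SB : Finset (Fin nE)) : Prop :=
  LinearIndependent ℝ (Sum.elim (fun k => net.equalityRows k)
    (fun k : {k // k ∈ SG.disjSum SB} => net.inequalityRows k.1))

/-- Admissible binding sets: `|S_G| + |S_B| = nG - 1` and `S_G ⊥ S_B`. -/
def Admissible (SG : Finset (Fin nG)) (SB : Finset (Fin nE)) : Prop :=
  SG.card + SB.card + 1 = nG ∧ net.Independent SG SB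

/-- The matrix with row blocks `I_{V_L} L`, `I_{S_G} L`, `I_{S_B} B Cᵀ` and `e₁ᵀ`. -/
def bindingMatrix (SG : Finset (Fin nG)) (SB : Finset (Fin nE)) :
    Matrix (Fin nL ⊕ (SG ⊕ (SB ⊕ Unit))) (Bus nG nL) ℝ :=
  Matrix.of (Sum.elim (fun j => net.laplacian (Sum.inr j))
    (Sum.elim (fun i => net.laplacian (Sum.inl i.1))
      (Sum.elim (fun e => net.flowMatrix e.1) (fun _ => Pi.single net.slack 1))))

open Classical in
/-- The matrix `Zᵀ`, the inverse of `bindingMatrix`. Since the rows and the columns of the latter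
have different index types, they are identified by some bijection, on which the inverse does not
depend. -/
noncomputable def bindingInverse (SG : Finset (Fin nG)) (SB : Finset (Fin nE)) :
    Matrix (Bus nG nL) (Fin nL ⊕ (SG ⊕ (SB ⊕ Unit))) ℝ :=
  if h : Nonempty ((Fin nL ⊕ (SG ⊕ (SB ⊕ Unit))) ≃ Bus nG nL) then
    ((net.bindingMatrix SG SB).submatrix h.some.symm id)⁻¹.submatrix id h.some
  else 0

/-- `J(S_G, S_B) = -Ψ (I_{[N_L]})ᵀ` with `Ψ = I_{V_G} L Zᵀ`: minus the block of `L Zᵀ` with rows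
the generator buses and with the first `nL` columns. -/
noncomputable def bindingJacobian (SG : Finset (Fin nG)) (SB : Finset (Fin nE)) :
    Matrix (Fin nG) (Fin nL) ℝ :=
  -((net.laplacian * net.bindingInverse SG SB).submatrix Sum.inl Sum.inl)

end Network

end DCOPF

open Filter Topology

set_option linter.unusedSectionVars false

namespace DCOPF

/-! ### Farkas' lemma -/

/-! The balance rows of the generator buses merely define the generation, so the problem is a linear
program in the angles alone (`isOptimal_iff`, `independent_iff`): `nL + 1` equality rows and
two-sided bounds on generations and flows, in dimension `nG + nL`. Hence `nG - 1` further
independent rows determine the angles, and `bindingMatrix` is invertible for admissible pairs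
(`bindingInverse_spec`).

Derivative at a generic load: Farkas' lemma and a Carathéodory reduction yield multipliers whose
support indexes independent rows. A cost in `costSet` forces at least `nG - 1` of them to be
nonzero, and only `nG - 1` inequalities bind, so the support is the binding set
(`exists_strictSolution`). Such a solution persists under small changes of limits and load: slack
bounds stay slack and the same multipliers certify optimality (`StrictSolution.eventually`). Near
the load the OPF operator is therefore affine with linear part `bindingJacobian`.

Realization of an admissible pair: a cost off finitely many hyperplanes lies in `costSet` and puts a
nonzero multiplier on each row of the pair. The signs of these multipliers say which limit has to
bind, and suitable limits are placed around a balanced injection. The configuration survives on an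
open set of limits. That set contains regular limits (`exists_mem_regularLimits`), because too many
binding rows would impose one of finitely many nontrivial linear relations on limits and load. It
therefore meets every dense subset of the regular limits (`StrictSolution.exists_mem_of_dense`). The
equality of the two sets of matrices combines both directions. -/

theorem farkas_finset {V ι : Type*} [AddCommGroup V] [Module ℝ V] (S : Finset ι) :
    ∀ (u : ι → V →ₗ[ℝ] ℝ) (g : V →ₗ[ℝ] ℝ),
      (∀ x, (∀ i ∈ S, 0 ≤ u i x) → 0 ≤ g x) →
      ∃ c : ι → ℝ, (∀ i, 0 ≤ c i) ∧ g = ∑ i ∈ S, c i • u i := by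
  classical
  induction S using Finset.induction_on with
  | empty =>
    intro u g h
    refine ⟨0, fun _ => le_rfl, LinearMap.ext fun x => ?_⟩
    have h₁ := h x (by simp)
    have h₂ := h (-x) (by simp)
    rw [map_neg] at h₂
    simp only [Finset.sum_empty, LinearMap.zero_apply]
    linarith
  | insert a S ha ih =>
    intro u g h
    by_cases hS : ∀ x, (∀ i ∈ S, 0 ≤ u i x) → 0 ≤ g x
    · obtain ⟨c, hc, rfl⟩ := ih u g hS
      refine ⟨fun i => if i = a then 0 else c i, fun i => ?_, ?_⟩
      · dsimp only; split_ifs <;> simp [hc]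
      · rw [Finset.sum_insert ha]
        simp only [if_true, zero_smul, zero_add]
        refine Finset.sum_congr rfl fun i hi => ?_
        rw [if_neg (ne_of_mem_of_not_mem hi ha)]
    · push Not at hS
      obtain ⟨x₁, hx₁, hg₁⟩ := hS
      have hu₁ : u a x₁ < 0 := by
        by_contra hcon
        push Not at hcon
        exact absurd (h x₁ fun i hi => by
          rcases Finset.mem_insert.1 hi with rfl | hi
          exacts [hcon, hx₁ i hi]) (not_le.2 hg₁)
      obtain ⟨x₀, hx₀, hg₀, hu₀⟩ : ∃ x₀, (∀ i ∈ S, 0 ≤ u i x₀) ∧ g x₀ < 0 ∧ u a x₀ = -1 := by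
        refine ⟨(-(u a x₁))⁻¹ • x₁, fun i hi => ?_, ?_, ?_⟩
        · rw [map_smul, smul_eq_mul]
          exact mul_nonneg (inv_nonneg.2 (by linarith)) (hx₁ i hi)
        · rw [map_smul, smul_eq_mul]
          exact mul_neg_of_pos_of_neg (inv_pos.2 (by linarith)) hg₁
        · rw [map_smul, smul_eq_mul, inv_neg, neg_mul, inv_mul_cancel₀ hu₁.ne]
      -- The map `x ↦ x + u a x • x₀` projects onto the kernel of `u a`. The induction hypothesis is
      -- applied to the functionals composed with this projection. Solving the result for `g` gives
      -- `u a` the coefficient `∑ c j * u j x₀ - g x₀`, which is nonnegative by the choice of `x₀`.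
      obtain ⟨c, hc, hgc⟩ := ih (fun i => u i + u i x₀ • u a) (g + g x₀ • u a) fun x hx => by
        have := h (x + u a x • x₀) fun i hi => by
          rcases Finset.mem_insert.1 hi with rfl | hi
          · simp [hu₀]
          · have := hx i hi
            simp only [LinearMap.add_apply, LinearMap.smul_apply, smul_eq_mul] at this
            simp only [map_add, map_smul, smul_eq_mul]
            linarith
        simp only [map_add, map_smul, smul_eq_mul] at this
        simp only [LinearMap.add_apply, LinearMap.smul_apply, smul_eq_mul]
        linarith
      refine ⟨fun i => if i = a then ∑ j ∈ S, c j * u j x₀ - g x₀ else c i, fun i => ?_, ?_⟩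
      · dsimp only
        split_ifs
        · have := Finset.sum_nonneg fun j hj => mul_nonneg (hc j) (hx₀ j hj)
          linarith
        · exact hc i
      · rw [Finset.sum_insert ha, Finset.sum_congr rfl
          (g := fun i => c i • u i) fun i hi => by
            simp only [if_neg (ne_of_mem_of_not_mem hi ha)]]
        simp only [if_true]
        ext x
        have := LinearMap.congr_fun hgc x
        simp only [LinearMap.add_apply, LinearMap.smul_apply, smul_eq_mul, LinearMap.sum_apply,
          mul_add, Finset.sum_add_distrib, ← mul_assoc, ← Finset.sum_mul] at this ⊢
        linear_combination this

/-- Farkas' lemma for the rows of a matrix. -/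
theorem farkas_matrix {m n : Type*} [Fintype m] [Fintype n] (U : Matrix m n ℝ) (g : n → ℝ)
    (h : ∀ x, (∀ i, 0 ≤ (U *ᵥ x) i) → 0 ≤ g ⬝ᵥ x) :
    ∃ c : m → ℝ, (∀ i, 0 ≤ c i) ∧ c ᵥ* U = g := by
  classical
  obtain ⟨c, hc, hg⟩ := farkas_finset Finset.univ
    (fun i => (LinearMap.proj i).comp U.mulVecLin) (dotProductBilin ℝ ℝ g)
    (fun x hx => h x fun i => hx i (Finset.mem_univ i))
  refine ⟨c, hc, ?_⟩
  refine dotProduct_eq _ _ fun x => ?_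
  have := LinearMap.congr_fun hg x
  simp only [dotProductBilin_apply_apply, LinearMap.sum_apply, LinearMap.smul_apply,
    LinearMap.comp_apply, Matrix.mulVecLin_apply, LinearMap.proj_apply, smul_eq_mul] at this
  rw [this, ← Matrix.dotProduct_mulVec]
  rfl

/-! ### Linear programs with two-sided bounds -/

section LinearProgram

variable {κ ι n : Type*} [Fintype κ] [Fintype ι] [Fintype n]

/-- `x` satisfies `C x = d` and `lo ≤ A x ≤ hi`. -/
structure BoxFeasible (C : Matrix κ n ℝ) (A : Matrix ι n ℝ) (d : κ → ℝ) (lo hi : ι → ℝ)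
    (x : n → ℝ) : Prop where
  eq : C *ᵥ x = d
  lower : ∀ i, lo i ≤ (A *ᵥ x) i
  upper : ∀ i, (A *ᵥ x) i ≤ hi i

/-- `x` minimizes `g ⬝ᵥ x` subject to `C x = d` and `lo ≤ A x ≤ hi`. -/
def BoxOptimal (C : Matrix κ n ℝ) (A : Matrix ι n ℝ) (d : κ → ℝ) (lo hi : ι → ℝ)
    (g x : n → ℝ) : Prop :=
  BoxFeasible C A d lo hi x ∧ ∀ x', BoxFeasible C A d lo hi x' → g ⬝ᵥ x ≤ g ⬝ᵥ x'

/-- Stationarity and complementary slackness, with one signed multiplier for each pair of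
bounds: it is positive only if the upper bound binds, negative only if the lower one does. -/
structure SignedKKT (C : Matrix κ n ℝ) (A : Matrix ι n ℝ) (lo hi : ι → ℝ) (g x : n → ℝ)
    (y : κ → ℝ) (w : ι → ℝ) : Prop where
  stationary : g + y ᵥ* C + w ᵥ* A = 0
  pos : ∀ i, 0 < w i → (A *ᵥ x) i = hi i
  neg : ∀ i, w i < 0 → (A *ᵥ x) i = lo i

/-- The rows of `C` and the rows of `A` in `S` are jointly linearly independent. -/
def IndepOn (C : Matrix κ n ℝ) (A : Matrix ι n ℝ) (S : Finset ι) : Prop :=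
  ∀ (y : κ → ℝ) (w : ι → ℝ), (∀ i ∉ S, w i = 0) → y ᵥ* C + w ᵥ* A = 0 → y = 0 ∧ w = 0

variable {C : Matrix κ n ℝ} {A : Matrix ι n ℝ} {d : κ → ℝ} {lo hi : ι → ℝ} {g x x' : n → ℝ}
  {y : κ → ℝ} {w : ι → ℝ}

/-- Stationarity paired with both points. For feasible `x'` every summand is nonnegative, so the
duality gap yields sufficiency of the conditions and, when it vanishes, complementary slackness at
every other optimum. -/
theorem SignedKKT.dotProduct_sub (h : SignedKKT C A lo hi g x y w) (hC : C *ᵥ x = C *ᵥ x') :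
    g ⬝ᵥ x' - g ⬝ᵥ x = ∑ i, w i * ((A *ᵥ x) i - (A *ᵥ x') i) := by
  have e : ∀ z, g ⬝ᵥ z + y ⬝ᵥ (C *ᵥ z) + w ⬝ᵥ (A *ᵥ z) = 0 := fun z => by
    rw [Matrix.dotProduct_mulVec, Matrix.dotProduct_mulVec, ← add_dotProduct, ← add_dotProduct,
      h.stationary, zero_dotProduct]
  have h₁ := e x
  have h₂ := e x'
  rw [← hC] at h₂
  have : ∑ i, w i * ((A *ᵥ x) i - (A *ᵥ x') i) = w ⬝ᵥ (A *ᵥ x) - w ⬝ᵥ (A *ᵥ x') := by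
    simp only [dotProduct, mul_sub, Finset.sum_sub_distrib]
  linarith

theorem SignedKKT.term_nonneg (h : SignedKKT C A lo hi g x y w)
    (hx' : BoxFeasible C A d lo hi x') (i : ι) :
    0 ≤ w i * ((A *ᵥ x) i - (A *ᵥ x') i) := by
  rcases lt_trichotomy (w i) 0 with hw | hw | hw
  · rw [h.neg i hw]
    exact mul_nonneg_of_nonpos_of_nonpos hw.le (sub_nonpos.2 (hx'.lower i))
  · simp [hw]
  · rw [h.pos i hw]
    exact mul_nonneg hw.le (sub_nonneg.2 (hx'.upper i))

theorem SignedKKT.boxOptimal (h : SignedKKT C A lo hi g x y w) (hx : BoxFeasible C A d lo hi x) :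
    BoxOptimal C A d lo hi g x := by
  refine ⟨hx, fun x' hx' => ?_⟩
  have := h.dotProduct_sub (hx.eq.trans hx'.eq.symm)
  have := Finset.sum_nonneg fun i (_ : i ∈ Finset.univ) => h.term_nonneg hx' i
  linarith

/-- Every optimal solution satisfies the complementary slackness conditions. -/
theorem SignedKKT.mulVec_eq_of_boxOptimal (h : SignedKKT C A lo hi g x y w)
    (hx : BoxFeasible C A d lo hi x) (hx' : BoxOptimal C A d lo hi g x') (i : ι) (hw : w i ≠ 0) :
    (A *ᵥ x') i = (A *ᵥ x) i := by
  have h₁ := h.dotProduct_sub (hx.eq.trans hx'.1.eq.symm)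
  have h₂ := hx'.2 x hx
  have h₃ := Finset.sum_nonneg fun i (_ : i ∈ Finset.univ) => h.term_nonneg hx'.1 i
  have h₄ := (Finset.sum_eq_zero_iff_of_nonneg
    fun i (_ : i ∈ Finset.univ) => h.term_nonneg hx'.1 i).1 (by linarith) i (Finset.mem_univ i)
  rcases mul_eq_zero.1 h₄ with h₅ | h₅
  · exact absurd h₅ hw
  · linarith

/-- From a feasible point one can move a little in every direction that does not violate the
binding constraints. -/
theorem BoxFeasible.exists_step (hx : BoxFeasible C A d lo hi x) {v : n → ℝ} (hC : C *ᵥ v = 0)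
    (hU : ∀ i, (A *ᵥ x) i = hi i → (A *ᵥ v) i ≤ 0)
    (hL : ∀ i, (A *ᵥ x) i = lo i → 0 ≤ (A *ᵥ v) i) :
    ∃ t : ℝ, 0 < t ∧ BoxFeasible C A d lo hi (x + t • v) := by
  have key : ∀ i, ∀ᶠ t : ℝ in 𝓝[>] 0,
      lo i ≤ (A *ᵥ x) i + t * (A *ᵥ v) i ∧ (A *ᵥ x) i + t * (A *ᵥ v) i ≤ hi i := by
    intro i
    have hlim : Tendsto (fun t : ℝ => (A *ᵥ x) i + t * (A *ᵥ v) i) (𝓝[>] 0)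
        (𝓝 ((A *ᵥ x) i)) := by
      have : Continuous fun t : ℝ => (A *ᵥ x) i + t * (A *ᵥ v) i := by fun_prop
      have := (this.tendsto 0).mono_left (nhdsWithin_le_nhds (s := Set.Ioi 0))
      simpa using this
    refine Filter.Eventually.and ?_ ?_
    · rcases (hx.lower i).eq_or_lt with h | h
      · filter_upwards [self_mem_nhdsWithin] with t ht
        have := mul_nonneg (le_of_lt ht) (hL i h.symm)
        linarith
      · filter_upwards [hlim.eventually (lt_mem_nhds h)] with t ht using ht.le
    · rcases (hx.upper i).eq_or_lt with h | h
      · filter_upwards [self_mem_nhdsWithin] with t ht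
        have := mul_nonneg (le_of_lt ht) (neg_nonneg.2 (hU i h))
        linarith
      · filter_upwards [hlim.eventually (gt_mem_nhds h)] with t ht using ht.le
  obtain ⟨t, ht, ht₀⟩ := ((eventually_all.2 key).and self_mem_nhdsWithin).exists
  refine ⟨t, ht₀, ?_, fun i => ?_, fun i => ?_⟩
  · rw [Matrix.mulVec_add, Matrix.mulVec_smul, hC, smul_zero, add_zero, hx.eq]
  · simpa [Matrix.mulVec_add, Matrix.mulVec_smul] using (ht i).1
  · simpa [Matrix.mulVec_add, Matrix.mulVec_smul] using (ht i).2

/-- At an optimum the cost cannot decrease along a direction in the kernel of `C` that respects the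
binding bounds, and Farkas' lemma turns this into multipliers. Equalities enter as two opposite
rows, and nonbinding bounds as zero rows, whose coefficients are discarded afterwards. -/
theorem BoxOptimal.exists_signedKKT (hx : BoxOptimal C A d lo hi g x) :
    ∃ y w, SignedKKT C A lo hi g x y w := by
  classical
  let U : (κ ⊕ κ) ⊕ (ι ⊕ ι) → n → ℝ := Sum.elim (Sum.elim (fun k => C k) (fun k => -C k))
    (Sum.elim (fun i => if (A *ᵥ x) i = hi i then -A i else 0)
      (fun i => if (A *ᵥ x) i = lo i then A i else 0))
  have hUv : ∀ v k, (Matrix.of U *ᵥ v) k = U k ⬝ᵥ v := fun _ _ => rfl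
  obtain ⟨c, hc, hcU⟩ := farkas_matrix (Matrix.of U) g fun v hv => by
    have hCv : C *ᵥ v = 0 := by
      ext k
      have h₁ := hv (Sum.inl (Sum.inl k))
      have h₂ := hv (Sum.inl (Sum.inr k))
      simp only [hUv, U, Sum.elim_inl, Sum.elim_inr,
        neg_dotProduct] at h₁ h₂
      change C k ⬝ᵥ v = 0
      linarith
    obtain ⟨t, ht, hf⟩ := hx.1.exists_step hCv
      (fun i hi' => by
        have := hv (Sum.inr (Sum.inl i))
        simp only [hUv, U, Sum.elim_inl, Sum.elim_inr, if_pos hi',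
          neg_dotProduct] at this
        change A i ⬝ᵥ v ≤ 0
        linarith)
      (fun i hi' => by
        have := hv (Sum.inr (Sum.inr i))
        simp only [hUv, U, Sum.elim_inr, if_pos hi'] at this
        exact this)
    have := hx.2 _ hf
    rw [dotProduct_add, dotProduct_smul, smul_eq_mul] at this
    exact nonneg_of_mul_nonneg_right (by linarith) ht
  refine ⟨fun k => c (Sum.inl (Sum.inr k)) - c (Sum.inl (Sum.inl k)),
    fun i => (if (A *ᵥ x) i = hi i then c (Sum.inr (Sum.inl i)) else 0)
      - (if (A *ᵥ x) i = lo i then c (Sum.inr (Sum.inr i)) else 0), ?_, fun i hi' => ?_,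
      fun i hi' => ?_⟩
  · rw [← hcU]
    ext j
    simp only [Pi.add_apply, Matrix.vecMul, dotProduct, Fintype.sum_sum_type, U, Matrix.of_apply,
      Sum.elim_inl, Sum.elim_inr, Pi.neg_apply, Pi.zero_apply, sub_mul, Finset.sum_sub_distrib]
    have e₁ : ∑ i, c (Sum.inr (Sum.inl i)) * (if (A *ᵥ x) i = hi i then -A i else 0) j
        = - ∑ i, (if (A *ᵥ x) i = hi i then c (Sum.inr (Sum.inl i)) else 0) * A i j := by
      rw [← Finset.sum_neg_distrib]
      exact Finset.sum_congr rfl fun i _ => by split_ifs <;> simp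
    have e₂ : ∑ i, c (Sum.inr (Sum.inr i)) * (if (A *ᵥ x) i = lo i then A i else 0) j
        = ∑ i, (if (A *ᵥ x) i = lo i then c (Sum.inr (Sum.inr i)) else 0) * A i j :=
      Finset.sum_congr rfl fun i _ => by split_ifs <;> simp
    rw [e₁, e₂]
    simp only [mul_neg, Finset.sum_neg_distrib]
    ring
  · by_contra h
    simp only [if_neg h] at hi'
    split_ifs at hi' <;> linarith [hc (Sum.inr (Sum.inr i))]
  · by_contra h
    simp only [if_neg h] at hi'
    split_ifs at hi' <;> linarith [hc (Sum.inr (Sum.inl i))]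

/-- Signed multipliers can be chosen such that the constraints with a nonzero multiplier are
linearly independent. -/
theorem SignedKKT.exists_indepOn [DecidableEq ι] (hC : ∀ y, y ᵥ* C = 0 → y = 0)
    (h : SignedKKT C A lo hi g x y w) :
    ∃ y' w', SignedKKT C A lo hi g x y' w' ∧ IndepOn C A (Finset.univ.filter (w' · ≠ 0)) := by
  induction hk : (Finset.univ.filter (w · ≠ 0)).card using Nat.strong_induction_on
    generalizing y w with
  | _ k ih =>
    by_cases hI : IndepOn C A (Finset.univ.filter (w · ≠ 0))
    · exact ⟨y, w, h, hI⟩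
    simp only [IndepOn, Finset.mem_filter, Finset.mem_univ, true_and, not_not] at hI
    push Not at hI
    obtain ⟨z, v, hv, hzv, hne⟩ := hI
    have hv₀ : (Finset.univ.filter (v · ≠ 0)).Nonempty := by
      by_contra hcon
      rw [Finset.not_nonempty_iff_eq_empty, Finset.filter_eq_empty_iff] at hcon
      have hv0 : v = 0 := funext fun i => not_not.1 (hcon (Finset.mem_univ i))
      rw [hv0, Matrix.zero_vecMul, add_zero] at hzv
      exact hne (hC z hzv) hv0
    -- Carathéodory reduction: with the smallest ratio, subtracting `t • v` kills the entry `i₀` and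
    -- reverses the sign of no other entry, so the sign conditions survive while the support
    -- shrinks.
    obtain ⟨i₀, hi₀, hmin⟩ := Finset.exists_min_image _ (fun i => |w i| / |v i|) hv₀
    rw [Finset.mem_filter] at hi₀
    set t := w i₀ / v i₀ with ht
    have hle : ∀ i, |t * v i| ≤ |w i| := by
      intro i
      by_cases hvi : v i = 0
      · simp [hvi]
      · have := hmin i (by simp [hvi])
        rw [abs_mul, ht, abs_div]
        exact (le_div_iff₀ (abs_pos.2 hvi)).1 this
    refine ih (Finset.univ.filter ((w - t • v) · ≠ 0)).card ?_ (y := y - t • z) (w := w - t • v)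
      ⟨?_, fun i hi' => h.pos i ?_, fun i hi' => h.neg i ?_⟩ rfl
    · rw [← hk]
      refine Finset.card_lt_card ⟨fun i hi' => ?_, fun hss => ?_⟩
      · rw [Finset.mem_filter] at hi' ⊢
        refine ⟨Finset.mem_univ i, fun hw => hi'.2 ?_⟩
        simp [hw, hv i hw]
      · have hw : w i₀ ≠ 0 := fun hw => hi₀.2 (hv _ hw)
        have := hss (Finset.mem_filter.2 ⟨Finset.mem_univ i₀, hw⟩)
        rw [Finset.mem_filter] at this
        refine this.2 ?_
        simp only [Pi.sub_apply, Pi.smul_apply, smul_eq_mul, ht]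
        field_simp [hi₀.2]
        ring
    · have e : g + (y - t • z) ᵥ* C + (w - t • v) ᵥ* A
          = (g + y ᵥ* C + w ᵥ* A) - t • (z ᵥ* C + v ᵥ* A) := by
        rw [Matrix.sub_vecMul, Matrix.sub_vecMul, Matrix.smul_vecMul, Matrix.smul_vecMul, smul_add]
        abel
      rw [e, h.stationary, hzv, smul_zero, sub_zero]
    · by_contra hcon
      simp only [Pi.sub_apply, Pi.smul_apply, smul_eq_mul] at hi'
      have h₁ := hle i
      have h₂ := neg_abs_le (t * v i)
      rw [abs_of_nonpos (not_lt.1 hcon)] at h₁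
      linarith
    · by_contra hcon
      simp only [Pi.sub_apply, Pi.smul_apply, smul_eq_mul] at hi'
      have h₁ := hle i
      have h₂ := le_abs_self (t * v i)
      rw [abs_of_nonneg (not_lt.1 hcon)] at h₁
      linarith

/-! ### Counting rows -/

/-- The linear combination of the rows of `C` and of the rows of `A` in `S`. -/
def rowCombination (C : Matrix κ n ℝ) (A : Matrix ι n ℝ) (S : Finset ι) :
    (κ → ℝ) × (S → ℝ) →ₗ[ℝ] (n → ℝ) :=
  C.vecMulLinear.coprod (A.submatrix (Subtype.val : S → ι) id).vecMulLinear

theorem vecMul_submatrix_val [DecidableEq ι] (S : Finset ι) (v : S → ℝ) :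
    v ᵥ* A.submatrix (Subtype.val : S → ι) id
      = (fun i => if h : i ∈ S then v ⟨i, h⟩ else 0) ᵥ* A := by
  ext j
  simp only [Matrix.vecMul, dotProduct, Matrix.submatrix_apply, id]
  rw [← Finset.sum_subset (Finset.subset_univ S)
    (fun i _ hi => by rw [dif_neg hi, zero_mul]), ← Finset.sum_coe_sort S]
  exact Finset.sum_congr rfl fun i _ => by simp

theorem indepOn_iff_ker [DecidableEq ι] {S : Finset ι} :
    IndepOn C A S ↔ LinearMap.ker (rowCombination C A S) = ⊥ := by
  rw [LinearMap.ker_eq_bot']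
  constructor
  · rintro h ⟨y, v⟩ hyv
    simp only [rowCombination, LinearMap.coprod_apply, Matrix.vecMulLinear_apply,
      vecMul_submatrix_val] at hyv
    obtain ⟨h₁, h₂⟩ := h _ _ (fun i hi => by rw [dif_neg hi]) hyv
    refine Prod.ext h₁ (funext fun i => ?_)
    simpa using congrFun h₂ i.1
  · intro h y w hw hyw
    have hw' : w = fun i => if h : i ∈ S then (fun i : S => w i) ⟨i, h⟩ else 0 := by
      funext i
      by_cases hi : i ∈ S
      · simp [hi]
      · simp [hi, hw i hi]
    rw [hw', ← vecMul_submatrix_val S (fun i : S => w i)] at hyw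
    have := h (y, fun i : S => w i) hyw
    rw [Prod.mk_eq_zero] at this
    refine ⟨this.1, funext fun i => ?_⟩
    by_cases hi : i ∈ S
    · exact congrFun this.2 ⟨i, hi⟩
    · exact hw i hi

/-- Independence bounds the number of rows by the dimension, so under `hcard` the rows form a basis.
-/
theorem IndepOn.exists_vecMul_add_eq [DecidableEq ι] {S : Finset ι} (h : IndepOn C A S)
    (hcard : Fintype.card n ≤ Fintype.card κ + S.card) (z : n → ℝ) :
    ∃ y w, (∀ i ∉ S, w i = 0) ∧ y ᵥ* C + w ᵥ* A = z := by
  rw [indepOn_iff_ker] at h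
  have hinj := LinearMap.ker_eq_bot.1 h
  have hle := LinearMap.finrank_le_finrank_of_injective hinj
  have hsurj := (LinearMap.injective_iff_surjective_of_finrank_eq_finrank
    (le_antisymm hle (by simpa using hcard))).1 hinj
  obtain ⟨⟨y, v⟩, hyv⟩ := hsurj z
  refine ⟨y, fun i => if h : i ∈ S then v ⟨i, h⟩ else 0, fun i hi => dif_neg hi, ?_⟩
  rw [← vecMul_submatrix_val]
  exact hyv

/-- The rows span, so `x` itself is a combination of rows that annihilate it, and `x ⬝ᵥ x = 0`. -/
theorem IndepOn.eq_zero_of_card [DecidableEq ι] {S : Finset ι} (h : IndepOn C A S)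
    (hcard : Fintype.card n ≤ Fintype.card κ + S.card) (hC : C *ᵥ x = 0)
    (hA : ∀ i ∈ S, (A *ᵥ x) i = 0) : x = 0 := by
  obtain ⟨y, w, hw, hyw⟩ := h.exists_vecMul_add_eq hcard x
  rw [← dotProduct_self_eq_zero]
  nth_rw 1 [← hyw]
  rw [add_dotProduct, ← Matrix.dotProduct_mulVec, ← Matrix.dotProduct_mulVec, hC, dotProduct_zero,
    zero_add]
  refine Finset.sum_eq_zero fun i _ => ?_
  by_cases hi : i ∈ S
  · rw [hA i hi, mul_zero]
  · rw [hw i hi, zero_mul]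

theorem not_indepOn_of_card_lt [DecidableEq ι] {S : Finset ι}
    (hcard : Fintype.card n < Fintype.card κ + S.card) : ¬ IndepOn C A S := by
  rw [indepOn_iff_ker]
  exact LinearMap.ker_ne_bot_of_finrank_lt (by simpa using hcard)

theorem exists_ne_zero_mulVec_eq_zero (C : Matrix κ n ℝ) (A : Matrix ι n ℝ) {S : Finset ι}
    (hcard : Fintype.card κ + S.card < Fintype.card n) :
    ∃ x ≠ 0, C *ᵥ x = 0 ∧ ∀ i ∈ S, (A *ᵥ x) i = 0 := by
  let φ : (n → ℝ) →ₗ[ℝ] (κ → ℝ) × (S → ℝ) :=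
    C.mulVecLin.prod (A.submatrix (Subtype.val : S → ι) id).mulVecLin
  obtain ⟨x, hx, hne⟩ := Submodule.exists_mem_ne_zero_of_ne_bot
    (LinearMap.ker_ne_bot_of_finrank_lt (f := φ) (by simpa using hcard))
  have hx' : φ x = 0 := hx
  exact ⟨x, hne, congrArg Prod.fst hx', fun i hi => congrFun (congrArg Prod.snd hx') ⟨i, hi⟩⟩

/-- An optimal solution exists if the constraints are consistent and bound every variable. -/
theorem BoxFeasible.exists_boxOptimal (hx : BoxFeasible C A d lo hi x)
    (hinj : ∀ v, C *ᵥ v = 0 → A *ᵥ v = 0 → v = 0) (g : n → ℝ) :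
    ∃ x', BoxOptimal C A d lo hi g x' := by
  let φ : (n → ℝ) →ₗ[ℝ] (κ → ℝ) × (ι → ℝ) := C.mulVecLin.prod A.mulVecLin
  have hφ : LinearMap.ker φ = ⊥ := by
    rw [LinearMap.ker_eq_bot']
    intro v hv
    exact hinj v (congrArg Prod.fst hv) (congrArg Prod.snd hv)
  -- An injective linear map between finite-dimensional spaces is a closed embedding, so the
  -- preimage of the compact box, which is the feasible set, is compact.
  have hcomp : IsCompact (φ ⁻¹' ({d} ×ˢ Set.Icc lo hi)) :=
    (LinearMap.isClosedEmbedding_of_injective hφ).isCompact_preimage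
      (isCompact_singleton.prod isCompact_Icc)
  have hmem : ∀ z, z ∈ φ ⁻¹' ({d} ×ˢ Set.Icc lo hi) ↔ BoxFeasible C A d lo hi z := fun z =>
    ⟨fun h => ⟨h.1, h.2.1, h.2.2⟩, fun h => ⟨h.eq, h.lower, h.upper⟩⟩
  obtain ⟨x', hx', hmin⟩ := hcomp.exists_isMinOn ⟨x, (hmem x).2 hx⟩
    (f := fun z => g ⬝ᵥ z) (by fun_prop)
  exact ⟨x', (hmem x').1 hx', fun z hz => hmin ((hmem z).2 hz)⟩

end LinearProgram

/-! ### Avoiding finitely many hyperplanes -/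

/-- A nonzero linear functional is not constant on a nonempty open set, so each removed hyperplane
leaves a nonempty open set. This provides generic costs, limits and loads alike. -/
theorem exists_mem_open_forall_ne {E α : Type*} [AddCommGroup E] [Module ℝ E]
    [TopologicalSpace E] [ContinuousAdd E] [ContinuousSMul ℝ E] (K : Finset α)
    (φ : α → E →ₗ[ℝ] ℝ) (hcont : ∀ k, Continuous (φ k)) (b : α → ℝ) {U : Set E}
    (hU : IsOpen U) (hne : U.Nonempty) (hφ : ∀ k ∈ K, φ k ≠ 0) :
    ∃ x ∈ U, ∀ k ∈ K, φ k x ≠ b k := by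
  classical
  induction K using Finset.induction_on generalizing U with
  | empty => exact ⟨hne.some, hne.some_mem, by simp⟩
  | insert a K ha ih =>
    obtain ⟨x, hx, hxK⟩ := ih (U := U ∩ {x | φ a x ≠ b a})
      (hU.inter (isOpen_ne_fun (hcont a) continuous_const)) (by
        by_contra hcon
        rw [Set.not_nonempty_iff_eq_empty, Set.eq_empty_iff_forall_notMem] at hcon
        have hcon' : ∀ x ∈ U, φ a x = b a := fun x hx => by
          by_contra h
          exact hcon x ⟨hx, h⟩
        obtain ⟨x₀, hx₀⟩ := hne
        refine hφ a (Finset.mem_insert_self _ _) (LinearMap.ext fun v => ?_)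
        have hc : Tendsto (fun t : ℝ => x₀ + t • v) (𝓝[>] 0) (𝓝 x₀) := by
          have : Continuous fun t : ℝ => x₀ + t • v := by fun_prop
          simpa using (this.tendsto 0).mono_left (nhdsWithin_le_nhds (s := Set.Ioi 0))
        obtain ⟨t, ht, ht₀⟩ := ((hc.eventually (hU.mem_nhds hx₀)).and self_mem_nhdsWithin).exists
        have h₁ := hcon' _ ht
        have h₂ := hcon' _ hx₀
        rw [map_add, map_smul, smul_eq_mul, h₂] at h₁
        have : t * φ a v = 0 := by linarith
        exact (mul_eq_zero.1 this).resolve_left (ne_of_gt ht₀))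
      (fun k hk => hφ k (Finset.mem_insert_of_mem hk))
    refine ⟨x, hx.1, fun k hk => ?_⟩
    rcases Finset.mem_insert.1 hk with rfl | hk
    exacts [hx.2, hxK k hk]

namespace Network

variable {nG nL nE : ℕ} (net : Network nG nL nE)

/-! ### The Laplacian -/

theorem tail_ne_head (e : Fin nE) : net.tail e ≠ net.head e := by
  have h := net.edges.mapsTo (Set.mem_univ e)
  exact (SimpleGraph.mem_edgeSet _).1 h |>.ne

theorem incidence_transpose_mulVec (θ : Bus nG nL → ℝ) (e : Fin nE) :
    (net.incidenceᵀ *ᵥ θ) e = θ (net.tail e) - θ (net.head e) := by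
  have hne := net.tail_ne_head e
  have : ∀ v, net.incidenceᵀ e v * θ v
      = (if v = net.tail e then θ v else 0) - (if v = net.head e then θ v else 0) := by
    intro v
    simp only [incidence, Matrix.transpose_apply, Matrix.of_apply]
    by_cases h₁ : v = net.tail e
    · simp [h₁, hne]
    · by_cases h₂ : v = net.head e <;> simp [h₁, h₂, hne.symm]
  simp only [Matrix.mulVec, dotProduct, this, Finset.sum_sub_distrib, Finset.sum_ite_eq',
    Finset.mem_univ, if_true]

theorem flowMatrix_mulVec (θ : Bus nG nL → ℝ) (e : Fin nE) :
    (net.flowMatrix *ᵥ θ) e = net.susceptance e * (θ (net.tail e) - θ (net.head e)) := by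
  rw [flowMatrix, ← Matrix.mulVec_mulVec, Matrix.mulVec_diagonal, incidence_transpose_mulVec]

theorem laplacian_transpose : net.laplacianᵀ = net.laplacian := by
  simp [laplacian, Matrix.transpose_mul, Matrix.mul_assoc]

theorem vecMul_laplacian (θ : Bus nG nL → ℝ) : θ ᵥ* net.laplacian = net.laplacian *ᵥ θ := by
  rw [← Matrix.mulVec_transpose, laplacian_transpose]

theorem eq_of_flow_eq_zero {θ : Bus nG nL → ℝ} (h : net.flowMatrix *ᵥ θ = 0)
    (u v : Bus nG nL) : θ u = θ v := by
  have hadj : ∀ u v, net.graph.Adj u v → θ u = θ v := by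
    intro u v huv
    obtain ⟨e, -, he⟩ := net.edges.surjOn ((SimpleGraph.mem_edgeSet _).2 huv)
    have := congrFun h e
    rw [flowMatrix_mulVec, Pi.zero_apply, mul_eq_zero] at this
    have := sub_eq_zero.1 (this.resolve_left (net.susceptance_pos e).ne')
    rcases Sym2.eq_iff.1 he with ⟨rfl, rfl⟩ | ⟨rfl, rfl⟩
    exacts [this, this.symm]
  obtain ⟨p⟩ := net.connected.preconnected u v
  induction p with
  | nil => rfl
  | cons h _ ih => exact (hadj _ _ h).trans ih

theorem dotProduct_laplacian_mulVec (θ : Bus nG nL → ℝ) :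
    θ ⬝ᵥ (net.laplacian *ᵥ θ) = ∑ e, net.susceptance e * (net.incidenceᵀ *ᵥ θ) e ^ 2 := by
  rw [laplacian, ← Matrix.mulVec_mulVec, ← Matrix.mulVec_mulVec, Matrix.dotProduct_mulVec,
    ← Matrix.mulVec_transpose, dotProduct]
  refine Finset.sum_congr rfl fun e _ => ?_
  rw [Matrix.mulVec_diagonal]
  ring

/-- The quadratic form of the Laplacian is a sum of squares with positive weights, so all flows
vanish, and connectedness makes the angles equal. -/
theorem eq_of_laplacian_eq_zero {θ : Bus nG nL → ℝ} (h : net.laplacian *ᵥ θ = 0)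
    (u v : Bus nG nL) : θ u = θ v := by
  refine net.eq_of_flow_eq_zero (funext fun e => ?_) u v
  have hsum := net.dotProduct_laplacian_mulVec θ
  rw [h, dotProduct_zero] at hsum
  have := (Finset.sum_eq_zero_iff_of_nonneg fun e _ =>
    mul_nonneg (net.susceptance_pos e).le (sq_nonneg _)).1 hsum.symm e (Finset.mem_univ e)
  rw [flowMatrix, ← Matrix.mulVec_mulVec, Matrix.mulVec_diagonal]
  have h0 := (mul_eq_zero.1 this).resolve_left (net.susceptance_pos e).ne'
  rw [pow_eq_zero_iff two_ne_zero] at h0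
  rw [h0, mul_zero, Pi.zero_apply]

theorem laplacian_mulVec_const (c : ℝ) : net.laplacian *ᵥ (fun _ => c) = 0 := by
  rw [laplacian, ← Matrix.mulVec_mulVec]
  have : net.incidenceᵀ *ᵥ (fun _ => c) = 0 := funext fun e => by
    rw [incidence_transpose_mulVec, sub_self, Pi.zero_apply]
  rw [this, Matrix.mulVec_zero]

theorem sum_laplacian_mulVec (θ : Bus nG nL → ℝ) : ∑ v, (net.laplacian *ᵥ θ) v = 0 := by
  have : ∑ v, (net.laplacian *ᵥ θ) v = (fun _ => 1) ⬝ᵥ (net.laplacian *ᵥ θ) := by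
    simp [dotProduct]
  rw [this, Matrix.dotProduct_mulVec, vecMul_laplacian, laplacian_mulVec_const, zero_dotProduct]

/-- The Laplacian maps onto the balanced injections. -/
theorem exists_laplacian_mulVec_eq [Nonempty (Bus nG nL)] {b : Bus nG nL → ℝ}
    (hb : ∑ v, b v = 0) : ∃ θ, net.laplacian *ᵥ θ = b := by
  -- Adding the all-ones matrix makes the Laplacian injective: summing coordinates removes the
  -- Laplacian part and forces `∑ v, θ v = 0`, after which `θ` is constant and hence zero. On
  -- preimages of balanced vectors the added term vanishes.
  let φ : (Bus nG nL → ℝ) →ₗ[ℝ] (Bus nG nL → ℝ) :=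
    (net.laplacian + Matrix.of fun _ _ => 1).mulVecLin
  have hφ : ∀ θ, φ θ = net.laplacian *ᵥ θ + fun _ => ∑ v, θ v := by
    intro θ
    simp only [φ, Matrix.mulVecLin_apply, Matrix.add_mulVec]
    congr 1
    ext u
    simp [Matrix.mulVec, dotProduct]
  have hsum : ∀ θ, ∑ v, φ θ v = 0 → ∑ v, θ v = 0 := by
    intro θ h
    simp only [hφ, Pi.add_apply, Finset.sum_add_distrib, sum_laplacian_mulVec, zero_add,
      Finset.sum_const, nsmul_eq_mul, mul_eq_zero, Nat.cast_eq_zero, Finset.card_eq_zero] at h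
    exact h.resolve_left Finset.univ_nonempty.ne_empty
  have hinj : Function.Injective φ := by
    refine LinearMap.ker_eq_bot.1 (LinearMap.ker_eq_bot'.2 fun θ h => ?_)
    have h₁ := hsum θ (by simp [h])
    have h₂ := h
    rw [hφ, h₁] at h₂
    have h₃ := net.eq_of_laplacian_eq_zero (θ := θ) (by simpa [← Pi.zero_def] using h₂)
    ext u
    rw [Finset.sum_congr rfl fun v _ => h₃ v u, Finset.sum_const, nsmul_eq_mul, mul_eq_zero,
      Nat.cast_eq_zero, Finset.card_eq_zero] at h₁
    exact h₁.resolve_left Finset.univ_nonempty.ne_empty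
  obtain ⟨θ, hθ⟩ := (LinearMap.injective_iff_surjective.1 hinj) b
  refine ⟨θ, ?_⟩
  have := hsum θ (by rw [hθ, hb])
  rw [hφ, this] at hθ
  simpa [← Pi.zero_def] using hθ

/-! ### The problem in terms of the voltage angles -/

variable [NeZero nG]

/-- The rows of the equality constraints on the angles: load balance and slack bus. -/
def angleEqualities : Matrix (Fin nL ⊕ Unit) (Bus nG nL) ℝ :=
  Matrix.of (Sum.elim (fun j => net.laplacian (Sum.inr j)) fun _ => Pi.single net.slack 1)

/-- The rows of the quantities bounded by the limits: generations and flows. -/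
def angleInequalities : Matrix (Fin nG ⊕ Fin nE) (Bus nG nL) ℝ :=
  Matrix.of (Sum.elim (fun i => net.laplacian (Sum.inl i)) fun e => net.flowMatrix e)

/-- The right-hand side of the equality constraints on the angles. -/
def equalityTarget (l : Fin nL → ℝ) : Fin nL ⊕ Unit → ℝ := Sum.elim (-l) 0

/-- The cost as a linear functional of the angles. -/
def angleCost (f : Fin nG → ℝ) : Bus nG nL → ℝ := Sum.elim f 0 ᵥ* net.laplacian

/-- The generation produced at given angles. -/
def generation (θ : Bus nG nL → ℝ) : Fin nG → ℝ := fun i => (net.laplacian *ᵥ θ) (Sum.inl i)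

end Network

section Bounds

variable {nG nE : ℕ}

/-- The lower limits of generations and flows. -/
def lowerBound (ξ : Limits nG nE) : Fin nG ⊕ Fin nE → ℝ := Sum.elim (sMin ξ) (pMin ξ)

/-- The upper limits of generations and flows. -/
def upperBound (ξ : Limits nG nE) : Fin nG ⊕ Fin nE → ℝ := Sum.elim (sMax ξ) (pMax ξ)

/-- The limits with given lower and upper bounds. -/
def limitsOf (lo hi : Fin nG ⊕ Fin nE → ℝ) : Limits nG nE :=
  (fun i => hi (Sum.inl i), fun i => lo (Sum.inl i), fun e => hi (Sum.inr e),
    fun e => lo (Sum.inr e))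

@[simp] theorem lowerBound_limitsOf (lo hi : Fin nG ⊕ Fin nE → ℝ) :
    lowerBound (limitsOf lo hi) = lo := by
  ext (i | i) <;> rfl

@[simp] theorem upperBound_limitsOf (lo hi : Fin nG ⊕ Fin nE → ℝ) :
    upperBound (limitsOf lo hi) = hi := by
  ext (i | i) <;> rfl

end Bounds

namespace Network

variable {nG nL nE : ℕ} (net : Network nG nL nE) [NeZero nG]

@[simp] theorem angleEqualities_mulVec_inl (θ : Bus nG nL → ℝ) (j : Fin nL) :
    (net.angleEqualities *ᵥ θ) (Sum.inl j) = (net.laplacian *ᵥ θ) (Sum.inr j) := rfl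

@[simp] theorem angleEqualities_mulVec_inr (θ : Bus nG nL → ℝ) (k : Unit) :
    (net.angleEqualities *ᵥ θ) (Sum.inr k) = θ net.slack := by
  change Pi.single net.slack 1 ⬝ᵥ θ = _
  simp

@[simp] theorem angleInequalities_mulVec_inl (θ : Bus nG nL → ℝ) (i : Fin nG) :
    (net.angleInequalities *ᵥ θ) (Sum.inl i) = (net.laplacian *ᵥ θ) (Sum.inl i) := rfl

/-- The feasible set of the problem in terms of the angles. -/
abbrev AngleFeasible (ξ : Limits nG nE) (l : Fin nL → ℝ) (θ : Bus nG nL → ℝ) : Prop :=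
  BoxFeasible net.angleEqualities net.angleInequalities (equalityTarget l) (lowerBound ξ)
    (upperBound ξ) θ

/-- Optimality in terms of the angles. -/
abbrev AngleOptimal (f : Fin nG → ℝ) (ξ : Limits nG nE) (l : Fin nL → ℝ)
    (θ : Bus nG nL → ℝ) : Prop :=
  BoxOptimal net.angleEqualities net.angleInequalities (equalityTarget l) (lowerBound ξ)
    (upperBound ξ) (net.angleCost f) θ

/-- Signed multipliers of the problem in terms of the angles. -/
abbrev AngleKKT (f : Fin nG → ℝ) (ξ : Limits nG nE) (θ : Bus nG nL → ℝ)
    (y : Fin nL ⊕ Unit → ℝ) (w : Fin nG ⊕ Fin nE → ℝ) : Prop :=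
  SignedKKT net.angleEqualities net.angleInequalities (lowerBound ξ) (upperBound ξ)
    (net.angleCost f) θ y w

variable {net} {ξ : Limits nG nE} {l : Fin nL → ℝ} {s : Fin nG → ℝ} {θ : Bus nG nL → ℝ}
  {f : Fin nG → ℝ}

/-- The balance equation splits by bus type: at generators it defines `s`, at loads it remains a
constraint on the angles. -/
theorem feasible_iff :
    net.Feasible ξ l s θ ↔ s = net.generation θ ∧ net.AngleFeasible ξ l θ := by
  constructor
  · intro h
    have hs : s = net.generation θ := funext fun i => (congrFun h.balance (Sum.inl i)).symm
    refine ⟨hs, ⟨?_, ?_, ?_⟩⟩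
    · ext (j | k)
      · exact congrFun h.balance (Sum.inr j)
      · simpa [equalityTarget] using h.slack_eq
    · subst hs
      rintro (i | e)
      exacts [h.gen_lower i, h.flow_lower e]
    · subst hs
      rintro (i | e)
      exacts [h.gen_upper i, h.flow_upper e]
  · rintro ⟨rfl, h⟩
    refine ⟨?_, ?_, fun i => h.lower (Sum.inl i), fun i => h.upper (Sum.inl i),
      fun e => h.lower (Sum.inr e), fun e => h.upper (Sum.inr e)⟩
    · simpa [equalityTarget] using congrFun h.eq (Sum.inr ())
    · ext (i | j)
      · rfl
      · exact congrFun h.eq (Sum.inl j)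

variable (net) in
theorem angleCost_dotProduct (f : Fin nG → ℝ) (θ : Bus nG nL → ℝ) :
    net.angleCost f ⬝ᵥ θ = f ⬝ᵥ net.generation θ := by
  rw [angleCost, ← Matrix.dotProduct_mulVec]
  simp [dotProduct, generation]

theorem isOptimal_iff :
    net.IsOptimal f ξ l s θ ↔ s = net.generation θ ∧ net.AngleOptimal f ξ l θ := by
  simp only [IsOptimal, feasible_iff, BoxOptimal, angleCost_dotProduct]
  constructor
  · rintro ⟨⟨rfl, h⟩, h'⟩
    exact ⟨rfl, h, fun θ' hθ' => h' _ θ' ⟨rfl, hθ'⟩⟩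
  · rintro ⟨rfl, h, h'⟩
    exact ⟨⟨rfl, h⟩, fun s' θ' ⟨hs, hθ'⟩ => hs ▸ h' θ' hθ'⟩

theorem mem_loadSet_iff : l ∈ net.loadSet ξ ↔ (∀ j, 0 < l j) ∧ ∃ θ, net.AngleFeasible ξ l θ := by
  simp [loadSet, feasible_iff]

/-! ### Lagrange multipliers in both formulations -/

/-- Signed multipliers of a given vector of Lagrange multipliers. -/
def signedMultiplier (m : Multipliers nG nL nE) : Fin nG ⊕ Fin nE → ℝ :=
  Sum.elim (m.lamU - m.lamL) (m.muU - m.muL)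

/-- Lagrange multipliers with given signed multipliers. -/
def splitMultipliers (f : Fin nG → ℝ) (y : Fin nL ⊕ Unit → ℝ) (w : Fin nG ⊕ Fin nE → ℝ) :
    Multipliers nG nL nE where
  -- At generators this value is forced by stationarity in the generation variables.
  τ := Sum.elim (fun i => f i + w (Sum.inl i)) fun j => y (Sum.inl j)
  τ₀ := y (Sum.inr ())
  lamU i := (w (Sum.inl i))⁺
  lamL i := (w (Sum.inl i))⁻
  muU e := (w (Sum.inr e))⁺
  muL e := (w (Sum.inr e))⁻

variable (net) in
/-- The stationarity conditions for the angles in both formulations have the same left-hand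
side. -/
theorem stationarity_eq (f : Fin nG → ℝ) (y : Fin nL ⊕ Unit → ℝ) (lam : Fin nG → ℝ)
    (mu : Fin nE → ℝ) :
    net.angleCost f + y ᵥ* net.angleEqualities + Sum.elim lam mu ᵥ* net.angleInequalities
      = net.laplacianᵀ *ᵥ (Sum.elim (f + lam) fun j => y (Sum.inl j))
        + Pi.single net.slack (y (Sum.inr ()))
        + (net.incidence * Matrix.diagonal net.susceptance) *ᵥ mu := by
  have e₁ : (net.incidence * Matrix.diagonal net.susceptance) *ᵥ mu = mu ᵥ* net.flowMatrix := by
    rw [flowMatrix, ← Matrix.mulVec_transpose, Matrix.transpose_mul, Matrix.transpose_transpose,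
      Matrix.diagonal_transpose]
  rw [e₁, Matrix.mulVec_transpose]
  ext v
  simp only [angleCost, Pi.add_apply, Matrix.vecMul, dotProduct, Fintype.sum_sum_type,
    Sum.elim_inl, Sum.elim_inr, angleEqualities, angleInequalities, Matrix.of_apply,
    Pi.zero_apply, zero_mul, Finset.sum_const_zero, add_zero, add_mul, Finset.sum_add_distrib,
    Finset.univ_unique, Finset.sum_singleton]
  have : y (Sum.inr default) * (Pi.single net.slack 1 : Bus nG nL → ℝ) v
      = (Pi.single net.slack (y (Sum.inr ())) : Bus nG nL → ℝ) v := by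
    by_cases h : v = net.slack
    · subst h; simp
    · simp [h]
  rw [this]
  ring

theorem _root_.DCOPF.eq_zero_of_dotProduct_eq_zero {α : Type*} [Fintype α] {a b : α → ℝ}
    (h : a ⬝ᵥ b = 0) (ha : ∀ i, 0 ≤ a i) (hb : ∀ i, b i ≤ 0) (i : α) (hi : a i ≠ 0) : b i = 0 := by
  have := (Finset.sum_eq_zero_iff_of_nonpos fun i _ =>
    mul_nonpos_of_nonneg_of_nonpos (ha i) (hb i)).1 h i (Finset.mem_univ i)
  exact (mul_eq_zero.1 this).resolve_left hi

/-- Multipliers are nonnegative, so a positive difference needs a nonzero upper multiplier and a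
negative one a nonzero lower multiplier, even if both are nonzero. -/
theorem IsKKT.angleKKT {m : Multipliers nG nL nE} (h : net.IsKKT f ξ l s θ m) :
    net.AngleKKT f ξ θ (Sum.elim (fun j => m.τ (Sum.inr j)) fun _ => m.τ₀)
      (signedMultiplier m) := by
  obtain ⟨rfl, -⟩ := feasible_iff.1 h.feasible
  refine ⟨?_, ?_, ?_⟩
  · rw [signedMultiplier, stationarity_eq]
    have : (Sum.elim (f + (m.lamU - m.lamL)) fun j => m.τ (Sum.inr j)) = m.τ := by
      ext (i | j)
      · have := h.stationary_gen i
        simp only [Sum.elim_inl, Pi.add_apply, Pi.sub_apply]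
        linarith
      · rfl
    simpa [this] using h.stationary_angle
  · rintro (i | e) hw
    · have := eq_zero_of_dotProduct_eq_zero h.compl_lamU h.lamU_nonneg
        (fun i => sub_nonpos.2 (h.feasible.gen_upper i)) i (fun h0 => by
          simp only [signedMultiplier, Sum.elim_inl, Pi.sub_apply, h0] at hw
          linarith [h.lamL_nonneg i])
      exact sub_eq_zero.1 this
    · have := eq_zero_of_dotProduct_eq_zero h.compl_muU h.muU_nonneg
        (fun i => sub_nonpos.2 (h.feasible.flow_upper i)) e (fun h0 => by
          simp only [signedMultiplier, Sum.elim_inr, Pi.sub_apply, h0] at hw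
          linarith [h.muL_nonneg e])
      exact sub_eq_zero.1 this
  · rintro (i | e) hw
    · have := eq_zero_of_dotProduct_eq_zero h.compl_lamL h.lamL_nonneg
        (fun i => sub_nonpos.2 (h.feasible.gen_lower i)) i (fun h0 => by
          simp only [signedMultiplier, Sum.elim_inl, Pi.sub_apply, h0] at hw
          linarith [h.lamU_nonneg i])
      exact (sub_eq_zero.1 this).symm
    · have := eq_zero_of_dotProduct_eq_zero h.compl_muL h.muL_nonneg
        (fun i => sub_nonpos.2 (h.feasible.flow_lower i)) e (fun h0 => by
          simp only [signedMultiplier, Sum.elim_inr, Pi.sub_apply, h0] at hw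
          linarith [h.muU_nonneg e])
      exact (sub_eq_zero.1 this).symm

/-- Positive and negative parts are never both nonzero, so this splitting preserves the number of
nonzero entries. The count in `costSet` thereby applies to signed multipliers. -/
theorem AngleKKT.isKKT {y : Fin nL ⊕ Unit → ℝ} {w : Fin nG ⊕ Fin nE → ℝ}
    (h : net.AngleKKT f ξ θ y w) (hθ : net.AngleFeasible ξ l θ) :
    net.IsKKT f ξ l (net.generation θ) θ (splitMultipliers f y w) := by
  have hpos : ∀ i, (w i)⁺ * ((net.angleInequalities *ᵥ θ) i - upperBound ξ i) = 0 := by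
    intro i
    rcases le_or_gt (w i) 0 with hw | hw
    · rw [posPart_of_nonpos hw, zero_mul]
    · rw [h.pos i hw, sub_self, mul_zero]
  have hneg : ∀ i, (w i)⁻ * (lowerBound ξ i - (net.angleInequalities *ᵥ θ) i) = 0 := by
    intro i
    rcases le_or_gt 0 (w i) with hw | hw
    · rw [negPart_of_nonneg hw, zero_mul]
    · rw [h.neg i hw, sub_self, mul_zero]
  refine ⟨feasible_iff.2 ⟨rfl, hθ⟩, ?_, fun i => ?_, fun _ => posPart_nonneg _,
    fun _ => negPart_nonneg _, fun _ => posPart_nonneg _, fun _ => negPart_nonneg _,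
    Finset.sum_eq_zero fun i _ => hpos (Sum.inl i), Finset.sum_eq_zero fun i _ => hneg (Sum.inl i),
    Finset.sum_eq_zero fun e _ => hpos (Sum.inr e), Finset.sum_eq_zero fun e _ => hneg (Sum.inr e)⟩
  · have e := stationarity_eq net f y (fun i => w (Sum.inl i)) fun e => w (Sum.inr e)
    have hw : Sum.elim (fun i => w (Sum.inl i)) (fun e => w (Sum.inr e)) = w := by
      ext (i | i) <;> rfl
    rw [hw, h.stationary] at e
    rw [e]
    congr 2
    ext i
    simp only [splitMultipliers, Pi.sub_apply]
    exact posPart_sub_negPart _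
  · have := posPart_sub_negPart (w (Sum.inl i))
    simp only [splitMultipliers, Sum.elim_inl]
    linarith

end Network

namespace Network

variable {nG nL nE : ℕ} [NeZero nG]

/-! ### Independence of constraint rows and invertibility of the binding system -/

section Rows

variable (net : Network nG nL nE)

/-- Summing coordinates removes the Laplacian part and leaves the slack coefficient, which is thus
zero. Then `y`, extended by zero to the generator buses, lies in the kernel of the Laplacian, so it
is constant, and it vanishes at a generator. -/
theorem eq_zero_of_angleEqualities_vecMul {y : Fin nL ⊕ Unit → ℝ}
    (h : y ᵥ* net.angleEqualities = 0) : y = 0 := by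
  have e := net.stationarity_eq 0 y 0 0
  have h0 : net.angleCost 0 = 0 := by
    have : (Sum.elim 0 0 : Bus nG nL → ℝ) = 0 := by ext (i | i) <;> rfl
    rw [angleCost, this, Matrix.zero_vecMul]
  have h1 : (Sum.elim 0 0 : Fin nG ⊕ Fin nE → ℝ) = 0 := by ext (i | i) <;> rfl
  rw [h0, h, h1, Matrix.zero_vecMul, Matrix.mulVec_zero, laplacian_transpose, add_zero, add_zero,
    add_zero, add_zero] at e
  have hy₀ : y (Sum.inr ()) = 0 := by
    have := congrArg (fun z => ∑ v, z v) e
    simp only [Pi.zero_apply, Pi.add_apply, Finset.sum_add_distrib, sum_laplacian_mulVec,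
      Finset.sum_const_zero, zero_add, Finset.sum_pi_single', Finset.mem_univ, if_true] at this
    exact this.symm
  rw [hy₀, Pi.single_zero, add_zero] at e
  ext (j | k)
  · exact net.eq_of_laplacian_eq_zero e.symm (Sum.inr j) (Sum.inl 0)
  · exact hy₀

theorem eq_zero_of_laplacian {θ : Bus nG nL → ℝ} (h : net.laplacian *ᵥ θ = 0)
    (h₀ : θ net.slack = 0) : θ = 0 :=
  funext fun v => (net.eq_of_laplacian_eq_zero h v net.slack).trans h₀

theorem eq_zero_of_generation {θ : Bus nG nL → ℝ} (h : net.angleEqualities *ᵥ θ = 0)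
    (hg : net.generation θ = 0) : θ = 0 := by
  refine net.eq_zero_of_laplacian ?_ (by simpa using congrFun h (Sum.inr ()))
  ext (i | j)
  exacts [congrFun hg i, congrFun h (Sum.inl j)]

/-- The generation columns read `w - τ`, so in a linear dependency `τ` agrees with `w` at the
generators. This is what allows `s` to be eliminated in `independent_iff`. -/
theorem sum_smul_rows (τ₀ : ℝ) (τ : Bus nG nL → ℝ) (w : Fin nG ⊕ Fin nE → ℝ)
    {S : Finset (Fin nG ⊕ Fin nE)} (hw : ∀ i ∉ S, w i = 0) :
    ∑ k, (Sum.elim (Sum.elim (fun _ => τ₀) τ) fun k : {k // k ∈ S} => w k.1) k •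
        (Sum.elim (fun k => net.equalityRows k)
          (fun k : {k // k ∈ S} => net.inequalityRows k.1)) k
      = Sum.elim (fun i => w (Sum.inl i) - τ (Sum.inl i))
          (Pi.single net.slack τ₀ + τ ᵥ* net.laplacian
            + (fun e => w (Sum.inr e)) ᵥ* net.flowMatrix) := by
  have hS : ∑ k : {k // k ∈ S}, w k.1 • net.inequalityRows k.1
      = ∑ k, w k • net.inequalityRows k := by
    rw [← Finset.sum_subset (Finset.subset_univ S)
      (fun i _ hi => by rw [hw i hi, zero_smul]), ← Finset.sum_coe_sort S]
  rw [Fintype.sum_sum_type]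
  simp only [Sum.elim_inl, Sum.elim_inr]
  rw [hS, Fintype.sum_sum_type, Fintype.sum_sum_type]
  simp only [Sum.elim_inl, Sum.elim_inr]
  ext (i | v)
  · simp [equalityRows, inequalityRows, Matrix.fromBlocks, Matrix.one_apply]
    ring
  · simp [equalityRows, inequalityRows, Matrix.fromBlocks, Matrix.vecMul, dotProduct,
      Pi.single_apply]

/-- The rows of the constraints in the variables `(s, θ)` are independent exactly if the
corresponding rows in the angles alone are. -/
theorem independent_iff {SG : Finset (Fin nG)} {SB : Finset (Fin nE)} :
    net.Independent SG SB ↔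
      IndepOn net.angleEqualities net.angleInequalities (SG.disjSum SB) := by
  have hvec : ∀ (y : Fin nL ⊕ Unit → ℝ) (w : Fin nG ⊕ Fin nE → ℝ),
      y ᵥ* net.angleEqualities + w ᵥ* net.angleInequalities
        = Pi.single net.slack (y (Sum.inr ()))
          + (Sum.elim (fun i => w (Sum.inl i)) fun j => y (Sum.inl j)) ᵥ* net.laplacian
          + (fun e => w (Sum.inr e)) ᵥ* net.flowMatrix := by
    intro y w
    ext v
    simp [Matrix.vecMul, dotProduct, angleEqualities, angleInequalities, Pi.single_apply]
    ring
  rw [Independent, Fintype.linearIndependent_iff]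
  constructor
  · intro h y w hw hyw
    have := h (Sum.elim (Sum.elim (fun _ => y (Sum.inr ()))
        (Sum.elim (fun i => w (Sum.inl i)) fun j => y (Sum.inl j))) fun k => w k.1) (by
      rw [net.sum_smul_rows _ _ _ hw, ← hvec, hyw]
      ext (i | v) <;> simp)
    constructor
    · ext (j | k)
      · exact this (Sum.inl (Sum.inr (Sum.inr j)))
      · exact this (Sum.inl (Sum.inl ()))
    · ext i
      by_cases hi : i ∈ SG.disjSum SB
      · exact this (Sum.inr ⟨i, hi⟩)
      · exact hw i hi
  · intro h c hc
    set w : Fin nG ⊕ Fin nE → ℝ := fun i =>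
      if hi : i ∈ SG.disjSum SB then c (Sum.inr ⟨i, hi⟩) else 0 with hw
    have hw₀ : ∀ i ∉ SG.disjSum SB, w i = 0 := fun i hi => dif_neg hi
    have hw₁ : ∀ k : {k // k ∈ SG.disjSum SB}, w k.1 = c (Sum.inr k) := fun k => dif_pos k.2
    have hcw : c = Sum.elim (Sum.elim (fun _ => c (Sum.inl (Sum.inl ())))
        fun b => c (Sum.inl (Sum.inr b))) fun k => w k.1 := by
      ext ((k | b) | k)
      · rfl
      · rfl
      · exact (hw₁ k).symm
    rw [hcw, net.sum_smul_rows _ _ _ hw₀] at hc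
    have hτ : ∀ i, c (Sum.inl (Sum.inr (Sum.inl i))) = w (Sum.inl i) := fun i =>
      (sub_eq_zero.1 (congrFun hc (Sum.inl i))).symm
    obtain ⟨hy, hw'⟩ := h (Sum.elim (fun j => c (Sum.inl (Sum.inr (Sum.inr j))))
      fun _ => c (Sum.inl (Sum.inl ()))) w hw₀ (by
        rw [hvec]
        have e : (Sum.elim (fun i => w (Sum.inl i)) fun j => c (Sum.inl (Sum.inr (Sum.inr j))))
            = fun b => c (Sum.inl (Sum.inr b)) := by
          ext (i | j)
          exacts [(hτ i).symm, rfl]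
        simp only [Sum.elim_inl, Sum.elim_inr]
        rw [e]
        exact funext fun v => congrFun hc (Sum.inr v))
    rintro ((k | b | b) | k)
    · exact congrFun hy (Sum.inr ())
    · rw [hτ, hw', Pi.zero_apply]
    · exact congrFun hy (Sum.inl b)
    · rw [← hw₁, hw', Pi.zero_apply]

variable {net} {SG : Finset (Fin nG)} {SB : Finset (Fin nE)}

/-- There are `nL + 1` equality rows and `nG + nL` angles, so `nG - 1` further rows suffice. -/
theorem card_bus_le {S : Finset (Fin nG ⊕ Fin nE)} (h : nG ≤ S.card + 1) :
    Fintype.card (Bus nG nL) ≤ Fintype.card (Fin nL ⊕ Unit) + S.card := by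
  simp only [Fintype.card_sum, Fintype.card_fin, Fintype.card_unit]
  omega

/-- The count makes the matrix square. A kernel vector is annihilated by as many independent rows as
there are angles, hence is zero. The arbitrary bijection of index types cancels in both products. -/
theorem bindingInverse_spec (hcard : SG.card + SB.card + 1 = nG)
    (h : IndepOn net.angleEqualities net.angleInequalities (SG.disjSum SB)) :
    net.bindingMatrix SG SB * net.bindingInverse SG SB = 1 ∧
      net.bindingInverse SG SB * net.bindingMatrix SG SB = 1 := by
  classical
  have hne : Nonempty ((Fin nL ⊕ (SG ⊕ (SB ⊕ Unit))) ≃ Bus nG nL) := by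
    refine ⟨Fintype.equivOfCardEq ?_⟩
    simp only [Fintype.card_sum, Fintype.card_fin, Fintype.card_unit, Fintype.card_coe]
    omega
  set e := hne.some with he
  set N := (net.bindingMatrix SG SB).submatrix e.symm id with hN
  have hM : net.bindingMatrix SG SB = N.submatrix e id := by
    rw [hN, Matrix.submatrix_submatrix]
    simp
  have hZ : net.bindingInverse SG SB = N⁻¹.submatrix id e := by
    rw [bindingInverse, dif_pos hne, hN, he]
  have hunit : IsUnit N := by
    rw [← Matrix.mulVec_injective_iff_isUnit]
    intro θ θ' hθ
    rw [← sub_eq_zero]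
    have hz : ∀ k, (net.bindingMatrix SG SB *ᵥ (θ - θ')) k = 0 := by
      intro k
      have := congrFun (sub_eq_zero.2 hθ) (e k)
      rw [← Matrix.mulVec_sub] at this
      rw [hM]
      exact this
    refine h.eq_zero_of_card (card_bus_le (by rw [Finset.card_disjSum]; omega)) ?_ ?_
    · ext (j | k)
      · exact hz (Sum.inl j)
      · exact hz (Sum.inr (Sum.inr (Sum.inr ())))
    · rintro (i | b) hi
      · exact hz (Sum.inr (Sum.inl ⟨i, Finset.inl_mem_disjSum.1 hi⟩))
      · exact hz (Sum.inr (Sum.inr (Sum.inl ⟨b, Finset.inr_mem_disjSum.1 hi⟩)))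
  have hdet := (Matrix.isUnit_iff_isUnit_det N).1 hunit
  rw [hM, hZ]
  constructor
  · rw [← Matrix.submatrix_mul _ _ e id e Function.bijective_id, Matrix.mul_nonsing_inv _ hdet,
      Matrix.submatrix_one_equiv]
  · rw [Matrix.submatrix_mul_equiv, Matrix.nonsing_inv_mul _ hdet, Matrix.submatrix_id_id]

end Rows

/-! ### Counting nonzero multipliers and binding inequalities -/

section Counting

variable {net : Network nG nL nE} {ξ : Limits nG nE} {l : Fin nL → ℝ} {s : Fin nG → ℝ}
  {θ : Bus nG nL → ℝ} {f : Fin nG → ℝ}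

theorem card_support_le_nonzeroCount (m : Multipliers nG nL nE) :
    (Finset.univ.filter (signedMultiplier m · ≠ 0)).card ≤ m.nonzeroCount := by
  have key : ∀ a b : ℝ, (if a - b ≠ 0 then 1 else 0)
      ≤ (if a ≠ 0 then 1 else 0) + (if b ≠ 0 then 1 else 0) := by
    intro a b
    by_cases ha : a = 0 <;> by_cases hb : b = 0 <;> simp [ha, hb]
    split_ifs <;> omega
  simp only [Multipliers.nonzeroCount, Finset.card_filter]
  rw [Fintype.sum_sum_type]
  simp only [signedMultiplier, Sum.elim_inl, Sum.elim_inr, Pi.sub_apply]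
  rw [add_assoc, ← Finset.sum_add_distrib, ← Finset.sum_add_distrib]
  exact add_le_add (Finset.sum_le_sum fun i _ => key _ _) (Finset.sum_le_sum fun e _ => key _ _)

theorem nonzeroCount_splitMultipliers (f : Fin nG → ℝ) (y : Fin nL ⊕ Unit → ℝ)
    (w : Fin nG ⊕ Fin nE → ℝ) :
    (splitMultipliers f y w).nonzeroCount = (Finset.univ.filter (w · ≠ 0)).card := by
  have key : ∀ a : ℝ, (if a ≠ 0 then 1 else 0)
      = (if a⁺ ≠ 0 then 1 else 0) + (if a⁻ ≠ 0 then 1 else 0) := by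
    intro a
    rcases lt_trichotomy a 0 with h | h | h
    · simp [posPart_of_nonpos h.le, negPart_of_nonpos h.le, h.ne]
    · simp [h]
    · simp [posPart_of_nonneg h.le, negPart_of_nonneg h.le, h.ne']
  simp only [Multipliers.nonzeroCount, Finset.card_filter]
  rw [add_assoc, ← Finset.sum_add_distrib, ← Finset.sum_add_distrib, Fintype.sum_sum_type]
  exact congrArg₂ _ (Finset.sum_congr rfl fun i _ => (key _).symm)
    (Finset.sum_congr rfl fun e _ => (key _).symm)

variable (net) in
/-- The generations and flows with a binding limit. -/
noncomputable def activeSet (ξ : Limits nG nE) (θ : Bus nG nL → ℝ) : Finset (Fin nG ⊕ Fin nE) :=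
  (net.bindingGens ξ (net.generation θ)).disjSum (net.bindingBranches ξ θ)

theorem mem_activeSet {i : Fin nG ⊕ Fin nE} :
    i ∈ net.activeSet ξ θ ↔ (net.angleInequalities *ᵥ θ) i = upperBound ξ i ∨
      (net.angleInequalities *ᵥ θ) i = lowerBound ξ i := by
  rcases i with i | e
  · rw [activeSet, Finset.inl_mem_disjSum, bindingGens, Finset.mem_filter]
    exact and_iff_right (Finset.mem_univ i)
  · rw [activeSet, Finset.inr_mem_disjSum, bindingBranches, Finset.mem_filter]
    exact and_iff_right (Finset.mem_univ e)

/-- `bindingCount` counts inequalities and `activeSet` counts indices. An active index whose two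
limits coincide contributes two inequalities, hence the second term. -/
theorem bindingCount_eq :
    net.bindingCount ξ (net.generation θ) θ
      = (net.activeSet ξ θ).card
        + ((net.activeSet ξ θ).filter fun i => lowerBound ξ i = upperBound ξ i).card := by
  have hact : net.activeSet ξ θ = Finset.univ.filter fun i =>
      (net.angleInequalities *ᵥ θ) i = upperBound ξ i ∨
        (net.angleInequalities *ᵥ θ) i = lowerBound ξ i := by
    ext i
    simp [mem_activeSet]
  have key : ∀ a b c : ℝ, (if a = b then 1 else 0) + (if a = c then 1 else 0)
      = (if a = b ∨ a = c then 1 else 0) + (if (a = b ∨ a = c) ∧ c = b then 1 else 0) := by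
    intro a b c
    by_cases hb : a = b <;> by_cases hc : a = c <;> simp_all
    exact fun h => hc h.symm
  rw [hact, Finset.filter_filter]
  simp only [bindingCount, Finset.card_filter, ← Finset.sum_add_distrib]
  rw [add_assoc, ← Finset.sum_add_distrib]
  simp only [key, Fintype.sum_sum_type]
  rfl

theorem AngleKKT.support_subset {y : Fin nL ⊕ Unit → ℝ} {w : Fin nG ⊕ Fin nE → ℝ}
    (h : net.AngleKKT f ξ θ y w) : Finset.univ.filter (w · ≠ 0) ⊆ net.activeSet ξ θ := by
  intro i hi
  rw [mem_activeSet]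
  rcases lt_or_gt_of_ne (Finset.mem_filter.1 hi).2 with hw | hw
  exacts [Or.inr (h.neg i hw), Or.inl (h.pos i hw)]

theorem exists_angleOptimal (hl : l ∈ net.loadSet ξ) (f : Fin nG → ℝ) :
    ∃ θ, net.AngleOptimal f ξ l θ := by
  obtain ⟨-, θ, hθ⟩ := mem_loadSet_iff.1 hl
  exact hθ.exists_boxOptimal (fun v hC hA => net.eq_zero_of_generation hC
    (funext fun i => congrFun hA (Sum.inl i))) _

theorem AngleOptimal.exists_angleKKT (h : net.AngleOptimal f ξ l θ) :
    ∃ y w, net.AngleKKT f ξ θ y w ∧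
      IndepOn net.angleEqualities net.angleInequalities (Finset.univ.filter (w · ≠ 0)) := by
  obtain ⟨y, w, hyw⟩ := h.exists_signedKKT
  exact hyw.exists_indepOn fun _ => net.eq_zero_of_angleEqualities_vecMul

theorem card_support_of_mem_costSet (hf : f ∈ net.costSet) (hξ : ξ ∈ net.limitSet)
    (hl : l ∈ net.loadSet ξ) (hθ : net.AngleOptimal f ξ l θ) {y : Fin nL ⊕ Unit → ℝ}
    {w : Fin nG ⊕ Fin nE → ℝ} (h : net.AngleKKT f ξ θ y w) :
    nG ≤ (Finset.univ.filter (w · ≠ 0)).card + 1 := by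
  rw [← nonzeroCount_splitMultipliers f y w]
  exact (hf.2 ξ hξ l hl).2 _ θ (isOptimal_iff.2 ⟨rfl, hθ⟩) _ (AngleKKT.isKKT h hθ.1)

theorem AngleOptimal.eq_of_mem_costSet (hf : f ∈ net.costSet) (hξ : ξ ∈ net.limitSet)
    (hl : l ∈ net.loadSet ξ) {θ' : Bus nG nL → ℝ} (hθ : net.AngleOptimal f ξ l θ)
    (hθ' : net.AngleOptimal f ξ l θ') : θ = θ' :=
  congrArg Prod.snd ((hf.2 ξ hξ l hl).1.unique
    (y₁ := (net.generation θ, θ)) (y₂ := (net.generation θ', θ'))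
    (isOptimal_iff.2 ⟨rfl, hθ⟩) (isOptimal_iff.2 ⟨rfl, hθ'⟩))

theorem opf_eq_generation (hf : f ∈ net.costSet) (hξ : ξ ∈ net.limitSet)
    (hl : l ∈ net.loadSet ξ) (hθ : net.AngleOptimal f ξ l θ) :
    net.opf f ξ l = net.generation θ := by
  have h : ∃ s θ, net.IsOptimal f ξ l s θ := ⟨_, θ, isOptimal_iff.2 ⟨rfl, hθ⟩⟩
  rw [opf, dif_pos h]
  obtain ⟨θ', hθ'⟩ := h.choose_spec
  rw [isOptimal_iff] at hθ'
  rw [hθ'.1, AngleOptimal.eq_of_mem_costSet hf hξ hl hθ hθ'.2]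

end Counting

/-! ### Generic costs -/

section GenericCost

variable {net : Network nG nL nE} {ξ : Limits nG nE} {l : Fin nL → ℝ} {θ : Bus nG nL → ℝ}
  {f : Fin nG → ℝ}

variable (net) in
/-- A cost vector for which stationarity needs at least `nG - 1` nonzero multipliers. -/
def GenericCost (f : Fin nG → ℝ) : Prop :=
  ∀ (y : Fin nL ⊕ Unit → ℝ) (w : Fin nG ⊕ Fin nE → ℝ),
    net.angleCost f + y ᵥ* net.angleEqualities + w ᵥ* net.angleInequalities = 0 →
      nG ≤ (Finset.univ.filter (w · ≠ 0)).card + 1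

variable (net) in
-- For a set `S` of at most `nG - 2` rows some nonzero `Θ S` is annihilated by `S` and by the
-- equalities. Stationarity with support `S` makes the cost orthogonal to the generation of `Θ S`,
-- which is a nonzero vector. It suffices to avoid these finitely many hyperplanes inside the
-- positive orthant.
theorem exists_genericCost : ∃ f : Fin nG → ℝ, (∀ i, 0 ≤ f i) ∧ net.GenericCost f := by
  have hex : ∀ S : Finset (Fin nG ⊕ Fin nE), S.card + 2 ≤ nG → ∃ θ : Bus nG nL → ℝ,
      θ ≠ 0 ∧ net.angleEqualities *ᵥ θ = 0 ∧ ∀ i ∈ S, (net.angleInequalities *ᵥ θ) i = 0 :=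
    fun S hS => exists_ne_zero_mulVec_eq_zero _ _ (by
      simp only [Fintype.card_sum, Fintype.card_fin, Fintype.card_unit]
      omega)
  choose! Θ hne hC hA using hex
  obtain ⟨f, hf, hfS⟩ := exists_mem_open_forall_ne
    (Finset.univ.filter fun S : Finset (Fin nG ⊕ Fin nE) => S.card + 2 ≤ nG)
    (fun S => dotProductBilin ℝ ℝ (net.generation (Θ S)))
    (fun S => LinearMap.continuous_of_finiteDimensional _) 0
    (U := Set.univ.pi fun _ => Set.Ioi 0) (isOpen_set_pi Set.finite_univ fun _ _ => isOpen_Ioi)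
    ⟨fun _ => 1, fun _ _ => by simp⟩ (fun S hS h0 => by
      rw [Finset.mem_filter] at hS
      refine hne S hS.2 (net.eq_zero_of_generation (hC S hS.2) ?_)
      rw [← dotProduct_self_eq_zero]
      exact LinearMap.congr_fun h0 _)
  refine ⟨f, fun i => (hf i (Set.mem_univ i)).le, fun y w h => ?_⟩
  by_contra hcon
  set S := Finset.univ.filter (w · ≠ 0) with hS
  have hcard : S.card + 2 ≤ nG := by omega
  refine hfS S (Finset.mem_filter.2 ⟨Finset.mem_univ _, hcard⟩) ?_
  change net.generation (Θ S) ⬝ᵥ f = 0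
  rw [dotProduct_comm, ← angleCost_dotProduct]
  have := congrArg (· ⬝ᵥ Θ S) h
  simp only [add_dotProduct, ← Matrix.dotProduct_mulVec, hC S hcard, dotProduct_zero, add_zero,
    zero_dotProduct] at this
  rwa [show w ⬝ᵥ (net.angleInequalities *ᵥ Θ S) = 0 from Finset.sum_eq_zero fun i _ => by
    by_cases hi : w i = 0
    · rw [hi, zero_mul]
    · rw [hA S hcard i (by simp [hS, hi]), mul_zero], add_zero] at this

/-- Two optima agree on every row with a nonzero multiplier. With independent support there are
enough such rows, along with the equalities, to determine the angles. -/
theorem GenericCost.mem_costSet (h : net.GenericCost f) (hf : ∀ i, 0 ≤ f i) :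
    f ∈ net.costSet := by
  refine ⟨hf, fun ξ _ l hl => ⟨?_, ?_⟩⟩
  · obtain ⟨θ, hθ⟩ := exists_angleOptimal hl f
    obtain ⟨y, w, hyw, hI⟩ := AngleOptimal.exists_angleKKT hθ
    refine ⟨(net.generation θ, θ), isOptimal_iff.2 ⟨rfl, hθ⟩, ?_⟩
    rintro ⟨s', θ'⟩ hopt
    obtain ⟨hs', hθ'⟩ := isOptimal_iff.1 hopt
    dsimp only at hs' hθ'
    subst hs'
    have : θ' - θ = 0 := by
      refine hI.eq_zero_of_card (card_bus_le (h y w hyw.stationary)) ?_ fun i hi => ?_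
      · rw [Matrix.mulVec_sub, hθ'.1.eq, hθ.1.eq, sub_self]
      · rw [Matrix.mulVec_sub, Pi.sub_apply,
          hyw.mulVec_eq_of_boxOptimal hθ.1 hθ' i (Finset.mem_filter.1 hi).2, sub_self]
    rw [sub_eq_zero.1 this]
  · intro s θ _ m hm
    exact (h _ _ hm.angleKKT.stationary).trans
      (Nat.add_le_add_right (card_support_le_nonzeroCount m) 1)

/-- For a generic cost vector, independent rows carry nonzero multipliers. -/
theorem GenericCost.exists_multipliers (h : net.GenericCost f) {S : Finset (Fin nG ⊕ Fin nE)}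
    (hcard : S.card + 1 = nG) (hI : IndepOn net.angleEqualities net.angleInequalities S) :
    ∃ y w, net.angleCost f + y ᵥ* net.angleEqualities + w ᵥ* net.angleInequalities = 0 ∧
      ∀ i, w i ≠ 0 ↔ i ∈ S := by
  obtain ⟨y, w, hw, hyw⟩ := hI.exists_vecMul_add_eq (card_bus_le hcard.ge) (-net.angleCost f)
  have hst : net.angleCost f + y ᵥ* net.angleEqualities + w ᵥ* net.angleInequalities = 0 := by
    rw [add_assoc, hyw, add_neg_cancel]
  refine ⟨y, w, hst, fun i => ?_⟩
  have hsub : Finset.univ.filter (w · ≠ 0) ⊆ S := fun i hi => by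
    by_contra hcon
    exact (Finset.mem_filter.1 hi).2 (hw i hcon)
  -- Genericity demands `nG - 1` nonzero entries, which is all of `S`.
  rw [← Finset.eq_of_subset_of_card_le hsub (by have := h y w hst; omega)]
  simp

end GenericCost

end Network

/-- The upper limits for the indices in `σ` and the lower limits for the others. -/
def boundSelection {nG nE : ℕ} (σ : Finset (Fin nG ⊕ Fin nE)) :
    Limits nG nE →ₗ[ℝ] (Fin nG ⊕ Fin nE → ℝ) where
  toFun ξ i := if i ∈ σ then upperBound ξ i else lowerBound ξ i
  map_add' ξ ξ' := by
    ext (i | i) <;> dsimp only [Pi.add_apply] <;> split_ifs <;> rfl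
  map_smul' c ξ := by
    ext (i | i) <;> dsimp only [Pi.smul_apply, RingHom.id_apply] <;> split_ifs <;> rfl

theorem boundSelection_apply {nG nE : ℕ} (σ : Finset (Fin nG ⊕ Fin nE)) (ξ : Limits nG nE)
    (i : Fin nG ⊕ Fin nE) :
    boundSelection σ ξ i = if i ∈ σ then upperBound ξ i else lowerBound ξ i := rfl

theorem continuous_lowerBound {nG nE : ℕ} (i : Fin nG ⊕ Fin nE) :
    Continuous fun ξ : Limits nG nE => lowerBound ξ i := by
  rcases i with i | e
  · exact (continuous_apply i).comp (continuous_fst.comp continuous_snd)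
  · exact (continuous_apply e).comp (continuous_snd.comp (continuous_snd.comp continuous_snd))

theorem continuous_upperBound {nG nE : ℕ} (i : Fin nG ⊕ Fin nE) :
    Continuous fun ξ : Limits nG nE => upperBound ξ i := by
  rcases i with i | e
  · exact (continuous_apply i).comp continuous_fst
  · exact (continuous_apply e).comp (continuous_fst.comp (continuous_snd.comp continuous_snd))

namespace Network

variable {nG nL nE : ℕ} [NeZero nG] (net : Network nG nL nE)

/-! ### The solution with prescribed binding limits -/

section BindingAngles

variable (SG : Finset (Fin nG)) (SB : Finset (Fin nE)) (σ : Finset (Fin nG ⊕ Fin nE))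

/-- The right-hand side of the system of the binding constraints. -/
def bindingTarget (ξ : Limits nG nE) (l : Fin nL → ℝ) : Fin nL ⊕ (SG ⊕ (SB ⊕ Unit)) → ℝ :=
  Sum.elim (-l) (Sum.elim (fun i => boundSelection σ ξ (Sum.inl i.1))
    (Sum.elim (fun e => boundSelection σ ξ (Sum.inr e.1)) 0))

/-- The angles at which the limits of `SG` and `SB` selected by `σ` bind. -/
noncomputable def bindingAngles (ξ : Limits nG nE) (l : Fin nL → ℝ) : Bus nG nL → ℝ :=
  net.bindingInverse SG SB *ᵥ bindingTarget SG SB σ ξ l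

theorem continuous_bindingAngles :
    Continuous fun p : Limits nG nE × (Fin nL → ℝ) => net.bindingAngles SG SB σ p.1 p.2 := by
  refine Continuous.matrix_mulVec continuous_const (continuous_pi ?_)
  have hb : ∀ i, Continuous fun p : Limits nG nE × (Fin nL → ℝ) => boundSelection σ p.1 i :=
    fun i => (continuous_apply i).comp
      ((LinearMap.continuous_of_finiteDimensional (boundSelection σ)).comp continuous_fst)
  rintro (j | i | e | k)
  · exact ((continuous_apply j).comp continuous_snd).neg
  · exact hb _
  · exact hb _
  · exact continuous_const

/-- The target depends on the load only through `-l` in the first block, which produces the first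
`nL` columns and the minus sign of `bindingJacobian`. -/
theorem generation_bindingAngles (ξ : Limits nG nE) (l : Fin nL → ℝ) :
    net.generation (net.bindingAngles SG SB σ ξ l)
      = net.bindingJacobian SG SB *ᵥ l + net.generation (net.bindingAngles SG SB σ ξ 0) := by
  have h : bindingTarget SG SB σ ξ l
      = (Sum.elim (-l) 0 : Fin nL ⊕ (SG ⊕ (SB ⊕ Unit)) → ℝ) + bindingTarget SG SB σ ξ 0 := by
    ext (j | i | e | k) <;> simp [bindingTarget]
  ext i
  simp only [generation, bindingAngles, h, Matrix.mulVec_add, Matrix.mulVec_mulVec, Pi.add_apply]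
  congr 1
  simp [bindingJacobian, Matrix.mulVec, dotProduct]

variable {SG SB σ} {net}

theorem bindingAngles_spec (h : net.bindingMatrix SG SB * net.bindingInverse SG SB = 1)
    (ξ : Limits nG nE) (l : Fin nL → ℝ) :
    net.angleEqualities *ᵥ net.bindingAngles SG SB σ ξ l = equalityTarget l ∧
      ∀ i ∈ SG.disjSum SB,
        (net.angleInequalities *ᵥ net.bindingAngles SG SB σ ξ l) i = boundSelection σ ξ i := by
  have key : net.bindingMatrix SG SB *ᵥ net.bindingAngles SG SB σ ξ l
      = bindingTarget SG SB σ ξ l := by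
    rw [bindingAngles, Matrix.mulVec_mulVec, h, Matrix.one_mulVec]
  constructor
  · ext (j | k)
    · exact congrFun key (Sum.inl j)
    · exact congrFun key (Sum.inr (Sum.inr (Sum.inr ())))
  · rintro (i | e) hi
    · exact congrFun key (Sum.inr (Sum.inl ⟨i, Finset.inl_mem_disjSum.1 hi⟩))
    · exact congrFun key (Sum.inr (Sum.inr (Sum.inl ⟨e, Finset.inr_mem_disjSum.1 hi⟩)))

theorem eq_bindingAngles (h : net.bindingInverse SG SB * net.bindingMatrix SG SB = 1)
    {ξ : Limits nG nE} {l : Fin nL → ℝ} {θ : Bus nG nL → ℝ}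
    (hC : net.angleEqualities *ᵥ θ = equalityTarget l)
    (hA : ∀ i ∈ SG.disjSum SB, (net.angleInequalities *ᵥ θ) i = boundSelection σ ξ i) :
    θ = net.bindingAngles SG SB σ ξ l := by
  have key : net.bindingMatrix SG SB *ᵥ θ = bindingTarget SG SB σ ξ l := by
    ext (j | i | e | k)
    · exact congrFun hC (Sum.inl j)
    · exact hA (Sum.inl i.1) (Finset.inl_mem_disjSum.2 i.2)
    · exact hA (Sum.inr e.1) (Finset.inr_mem_disjSum.2 e.2)
    · exact congrFun hC (Sum.inr ())
  rw [bindingAngles, ← key, Matrix.mulVec_mulVec, h, Matrix.one_mulVec]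

end BindingAngles

variable {net} {ξ : Limits nG nE} {l : Fin nL → ℝ} {θ : Bus nG nL → ℝ} {f : Fin nG → ℝ}

/-! ### Persistence of the binding limits -/

/-- `θ` satisfies the optimality conditions for the limits `ξ` and the load `l`, the binding
limits are those of `SG` and `SB`, their rows are independent and their multipliers do not
vanish. -/
structure StrictSolution (net : Network nG nL nE) (f : Fin nG → ℝ) (ξ : Limits nG nE)
    (l : Fin nL → ℝ) (θ : Bus nG nL → ℝ) (SG : Finset (Fin nG)) (SB : Finset (Fin nE))
    (y : Fin nL ⊕ Unit → ℝ) (w : Fin nG ⊕ Fin nE → ℝ) : Prop where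
  feasible : net.AngleFeasible ξ l θ
  kkt : net.AngleKKT f ξ θ y w
  support : ∀ i, w i ≠ 0 ↔ i ∈ SG.disjSum SB
  active : net.activeSet ξ θ = SG.disjSum SB
  bounds : ∀ i, i ∈ SG.disjSum SB → lowerBound ξ i < upperBound ξ i
  admissible : net.Admissible SG SB

variable {SG : Finset (Fin nG)} {SB : Finset (Fin nE)} {y : Fin nL ⊕ Unit → ℝ}
  {w : Fin nG ⊕ Fin nE → ℝ}

theorem Admissible.inverse_spec (h : net.Admissible SG SB) :
    net.bindingMatrix SG SB * net.bindingInverse SG SB = 1 ∧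
      net.bindingInverse SG SB * net.bindingMatrix SG SB = 1 :=
  bindingInverse_spec h.1 (net.independent_iff.1 h.2)

/-- The sign of the nonzero multiplier tells which of the two limits binds. -/
theorem StrictSolution.eq_bindingAngles (h : net.StrictSolution f ξ l θ SG SB y w) :
    θ = net.bindingAngles SG SB (Finset.univ.filter (0 < w ·)) ξ l := by
  refine Network.eq_bindingAngles h.admissible.inverse_spec.2 h.feasible.eq fun i hi => ?_
  rw [boundSelection_apply]
  split_ifs with hσ
  · exact h.kkt.pos i (Finset.mem_filter.1 hσ).2
  · refine h.kkt.neg i (lt_of_le_of_ne ?_ ((h.support i).2 hi))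
    exact not_lt.1 fun hw => hσ (Finset.mem_filter.2 ⟨Finset.mem_univ i, hw⟩)

/-- Small changes of the limits and of the load do not change the binding limits. -/
theorem StrictSolution.eventually (h : net.StrictSolution f ξ l θ SG SB y w) :
    ∀ᶠ p : Limits nG nE × (Fin nL → ℝ) in 𝓝 (ξ, l),
      net.StrictSolution f p.1 p.2
          (net.bindingAngles SG SB (Finset.univ.filter (0 < w ·)) p.1 p.2) SG SB y w ∧
        ∀ i, lowerBound p.1 i < upperBound p.1 i := by
  set σ := Finset.univ.filter (0 < w ·) with hσ
  have hcont : ∀ i, Continuous fun p : Limits nG nE × (Fin nL → ℝ) =>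
      (net.angleInequalities *ᵥ net.bindingAngles SG SB σ p.1 p.2) i := fun i =>
    (continuous_apply i).comp
      (Continuous.matrix_mulVec continuous_const (net.continuous_bindingAngles SG SB σ))
  have hlo : ∀ i, Continuous fun p : Limits nG nE × (Fin nL → ℝ) => lowerBound p.1 i :=
    fun i => (continuous_lowerBound i).comp continuous_fst
  have hhi : ∀ i, Continuous fun p : Limits nG nE × (Fin nL → ℝ) => upperBound p.1 i :=
    fun i => (continuous_upperBound i).comp continuous_fst
  have hout : ∀ i ∉ SG.disjSum SB, ∀ᶠ p : Limits nG nE × (Fin nL → ℝ) in 𝓝 (ξ, l),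
      lowerBound p.1 i < (net.angleInequalities *ᵥ net.bindingAngles SG SB σ p.1 p.2) i ∧
        (net.angleInequalities *ᵥ net.bindingAngles SG SB σ p.1 p.2) i < upperBound p.1 i := by
    intro i hi
    rw [← h.active, mem_activeSet, not_or] at hi
    have hlow := lt_of_le_of_ne (h.feasible.lower i) (Ne.symm hi.2)
    have hupp := lt_of_le_of_ne (h.feasible.upper i) hi.1
    rw [h.eq_bindingAngles] at hlow hupp
    exact ((hlo i).tendsto (ξ, l) |>.eventually_lt ((hcont i).tendsto (ξ, l)) hlow).and
      ((hcont i).tendsto (ξ, l) |>.eventually_lt ((hhi i).tendsto (ξ, l)) hupp)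
  have hin : ∀ i ∈ SG.disjSum SB, ∀ᶠ p : Limits nG nE × (Fin nL → ℝ) in 𝓝 (ξ, l),
      lowerBound p.1 i < upperBound p.1 i := fun i hi =>
    (hlo i).tendsto (ξ, l) |>.eventually_lt ((hhi i).tendsto (ξ, l)) (h.bounds i hi)
  have hout' := (Filter.eventually_all_finite (Set.toFinite {i | i ∉ SG.disjSum SB})).2 hout
  have hin' := (Filter.eventually_all_finite (Set.toFinite {i | i ∈ SG.disjSum SB})).2 hin
  filter_upwards [hout', hin'] with p hp₁ hp₂
  obtain ⟨hC, hA⟩ := bindingAngles_spec (σ := σ) h.admissible.inverse_spec.1 p.1 p.2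
  have hbd : ∀ i, lowerBound p.1 i < upperBound p.1 i := fun i => by
    by_cases hi : i ∈ SG.disjSum SB
    · exact hp₂ i hi
    · exact (hp₁ i hi).1.trans (hp₁ i hi).2
  -- Stationarity involves neither the limits nor the load, so `y` and `w` are kept. Only
  -- feasibility and the binding set need checking.
  refine ⟨⟨⟨hC, fun i => ?_, fun i => ?_⟩, ⟨h.kkt.stationary, fun i hi => ?_, fun i hi => ?_⟩,
    h.support, ?_, hp₂, h.admissible⟩, hbd⟩
  · by_cases hi : i ∈ SG.disjSum SB
    · rw [hA i hi, boundSelection_apply]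
      split_ifs
      exacts [(hbd i).le, le_rfl]
    · exact (hp₁ i hi).1.le
  · by_cases hi : i ∈ SG.disjSum SB
    · rw [hA i hi, boundSelection_apply]
      split_ifs
      exacts [le_rfl, (hbd i).le]
    · exact (hp₁ i hi).2.le
  · rw [hA i ((h.support i).1 hi.ne'), boundSelection_apply, if_pos (by simp [hσ, hi])]
  · rw [hA i ((h.support i).1 hi.ne), boundSelection_apply, if_neg (by simp [hσ, hi.le])]
  · ext i
    rw [mem_activeSet]
    by_cases hi : i ∈ SG.disjSum SB
    · rw [hA i hi, boundSelection_apply]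
      split_ifs <;> simp [hi]
    · simp [hi, (hp₁ i hi).1.ne', (hp₁ i hi).2.ne]

theorem StrictSolution.angleOptimal (h : net.StrictSolution f ξ l θ SG SB y w) :
    net.AngleOptimal f ξ l θ := h.kkt.boxOptimal h.feasible

theorem StrictSolution.bindingGens_eq (h : net.StrictSolution f ξ l θ SG SB y w) :
    net.bindingGens ξ (net.generation θ) = SG := by
  ext i
  have := congrArg (Sum.inl i ∈ ·) h.active
  simpa [activeSet] using this

theorem StrictSolution.bindingBranches_eq (h : net.StrictSolution f ξ l θ SG SB y w) :
    net.bindingBranches ξ θ = SB := by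
  ext e
  have := congrArg (Sum.inr e ∈ ·) h.active
  simpa [activeSet] using this

theorem StrictSolution.mem_genericLoads (h : net.StrictSolution f ξ l θ SG SB y w)
    (hl : ∀ j, 0 < l j) : l ∈ net.genericLoads ξ f := by
  refine ⟨mem_loadSet_iff.2 ⟨hl, θ, h.feasible⟩, net.generation θ, θ,
    isOptimal_iff.2 ⟨rfl, h.angleOptimal⟩, ?_⟩
  rw [bindingCount_eq, h.active, Finset.filter_eq_empty_iff.2 fun {i} hi => (h.bounds i hi).ne,
    Finset.card_empty, add_zero, Finset.card_disjSum]
  exact h.admissible.1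

/-- An independent support has at least `nG - 1` elements and is contained in the active set, while
only `nG - 1` inequalities bind. All these counts are thus equal: support and active set coincide,
and no active index has equal limits. -/
theorem exists_strictSolution (hf : f ∈ net.costSet) (hξ : ξ ∈ net.limitSet)
    (hl : l ∈ net.genericLoads ξ f) :
    ∃ θ SG SB y w, net.StrictSolution f ξ l θ SG SB y w := by
  obtain ⟨hl, s, θ, hopt, hcount⟩ := hl
  obtain ⟨rfl, hθ⟩ := isOptimal_iff.1 hopt
  obtain ⟨y, w, hyw, hI⟩ := AngleOptimal.exists_angleKKT hθ
  have hcard := card_support_of_mem_costSet hf hξ hl hθ hyw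
  have hsub := AngleKKT.support_subset hyw
  have hle := Finset.card_le_card hsub
  rw [bindingCount_eq] at hcount
  have hsupp := Finset.eq_of_subset_of_card_le hsub (by omega)
  have hempty : ((net.activeSet ξ θ).filter fun i => lowerBound ξ i = upperBound ξ i) = ∅ :=
    Finset.card_eq_zero.1 (by omega)
  rw [hsupp] at hI
  have hc : (net.activeSet ξ θ).card
      = (net.bindingGens ξ (net.generation θ)).card + (net.bindingBranches ξ θ).card :=
    Finset.card_disjSum _ _
  refine ⟨θ, net.bindingGens ξ (net.generation θ), net.bindingBranches ξ θ, y, w, hθ.1, hyw,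
    fun i => ?_, rfl, fun i hi => ?_, by omega, net.independent_iff.2 hI⟩
  · change _ ↔ i ∈ net.activeSet ξ θ
    rw [← hsupp]
    simp
  · exact lt_of_le_of_ne ((hθ.1.lower i).trans (hθ.1.upper i))
      (Finset.filter_eq_empty_iff.1 hempty hi)

/-! ### The derivative of the OPF operator -/

/-- The binding limits persist near `l`, where the operator is therefore the affine map of
`generation_bindingAngles`. -/
theorem StrictSolution.hasFDerivAt_opf (h : net.StrictSolution f ξ l θ SG SB y w)
    (hf : f ∈ net.costSet) (hξ : ξ ∈ net.limitSet) (hl : ∀ j, 0 < l j) :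
    HasFDerivAt (net.opf f ξ)
      (LinearMap.toContinuousLinearMap (net.bindingJacobian SG SB).mulVecLin) l := by
  have hpos : ∀ᶠ l' in 𝓝 l, ∀ j, 0 < l' j := eventually_all.2 fun j =>
    ((continuous_apply j).tendsto l).eventually (lt_mem_nhds (hl j))
  have hev : net.opf f ξ =ᶠ[𝓝 l] fun l' => net.bindingJacobian SG SB *ᵥ l'
      + net.generation (net.bindingAngles SG SB (Finset.univ.filter (0 < w ·)) ξ 0) := by
    have := (Continuous.prodMk_right ξ).tendsto l |>.eventually h.eventually
    filter_upwards [this, hpos] with l' h' hl'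
    rw [opf_eq_generation hf hξ (mem_loadSet_iff.2 ⟨hl', _, h'.1.feasible⟩) h'.1.angleOptimal,
      generation_bindingAngles]
  refine HasFDerivAt.congr_of_eventuallyEq ?_ hev
  exact (ContinuousLinearMap.hasFDerivAt
    (LinearMap.toContinuousLinearMap (net.bindingJacobian SG SB).mulVecLin)).add_const _

theorem jacobian_eq_of_hasFDerivAt {M : Matrix (Fin nG) (Fin nL) ℝ}
    (h : HasFDerivAt (net.opf f ξ) (LinearMap.toContinuousLinearMap M.mulVecLin) l) :
    net.jacobian f ξ l = M := by
  ext i j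
  have hu : HasDerivAt (Function.update l j) (Pi.single j 1) (l j) := hasDerivAt_update l j (l j)
  rw [← Function.update_eq_self j l] at h
  have := (hasDerivAt_pi.1 (h.comp_hasDerivAt (l j)
    (by simpa using hu))) i
  have e := this.deriv
  simp only [jacobian, Matrix.of_apply]
  refine e.trans ?_
  simp

/-! ### Generic limits and loads -/

/-- For a convex set with an interior point, the closure of the interior is the closure. This gives
the first regularity condition. -/
theorem convex_loadSet (ξ : Limits nG nE) : Convex ℝ (net.loadSet ξ) := by
  intro l hl l' hl' a b ha hb hab
  obtain ⟨hp, θ, hθ⟩ := mem_loadSet_iff.1 hl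
  obtain ⟨hp', θ', hθ'⟩ := mem_loadSet_iff.1 hl'
  refine mem_loadSet_iff.2 ⟨fun j => ?_, a • θ + b • θ', ?_, fun i => ?_, fun i => ?_⟩
  · exact (convex_Ioi (0 : ℝ)) (hp j) (hp' j) ha hb hab
  · rw [Matrix.mulVec_add, Matrix.mulVec_smul, Matrix.mulVec_smul, hθ.eq, hθ'.eq]
    ext (j | k) <;> simp [equalityTarget]
    ring
  · rw [Matrix.mulVec_add, Matrix.mulVec_smul, Matrix.mulVec_smul]
    exact (convex_Ici (lowerBound ξ i)) (hθ.lower i) (hθ'.lower i) ha hb hab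
  · rw [Matrix.mulVec_add, Matrix.mulVec_smul, Matrix.mulVec_smul]
    exact (convex_Iic (upperBound ξ i)) (hθ.upper i) (hθ'.upper i) ha hb hab

variable (net) in
/-- For each set of `nG` indices a linear dependency between the rows of the equality constraints
and the rows with these indices. -/
theorem exists_dependency (T : Finset (Fin nG ⊕ Fin nE)) (hT : T.card = nG) :
    ∃ (y : Fin nL ⊕ Unit → ℝ) (w : Fin nG ⊕ Fin nE → ℝ), (∀ i ∉ T, w i = 0) ∧
      y ᵥ* net.angleEqualities + w ᵥ* net.angleInequalities = 0 ∧
      ((fun j => y (Sum.inl j)) = 0 → w ≠ 0) := by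
  have h := not_indepOn_of_card_lt (C := net.angleEqualities) (A := net.angleInequalities)
    (S := T) (by
      simp only [Fintype.card_sum, Fintype.card_fin, Fintype.card_unit]
      omega)
  simp only [IndepOn] at h
  push Not at h
  obtain ⟨y, w, hw, hyw, hne⟩ := h
  -- If `w` vanished, a relation among the equality rows alone would remain, and these are
  -- independent.
  refine ⟨y, w, hw, hyw, fun _ hw₀ => hne ?_ hw₀⟩
  rw [hw₀, Matrix.zero_vecMul, add_zero] at hyw
  exact net.eq_zero_of_angleEqualities_vecMul hyw

/-- A dependency of rows becomes a linear relation between the load and the bounded quantities.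
Where these sit at their limits, it is a relation between load and limits. -/
theorem dependency_apply (hw : y ᵥ* net.angleEqualities + w ᵥ* net.angleInequalities = 0)
    (hθ : net.AngleFeasible ξ l θ) :
    (fun j => y (Sum.inl j)) ⬝ᵥ l = w ⬝ᵥ (net.angleInequalities *ᵥ θ) := by
  have := congrArg (· ⬝ᵥ θ) hw
  simp only [add_dotProduct, ← Matrix.dotProduct_mulVec, hθ.eq, zero_dotProduct] at this
  have e : y ⬝ᵥ equalityTarget l = -((fun j => y (Sum.inl j)) ⬝ᵥ l) := by
    simp [dotProduct, equalityTarget]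
  linarith

variable (net) in
/-- In every open set there are limits that are regular as soon as the load set has interior
points and no bounds coincide. -/
theorem exists_mem_regularLimits (hf : f ∈ net.costSet) {U : Set (Limits nG nE)} (hU : IsOpen U)
    (hne : U.Nonempty) :
    ∃ ξ ∈ U, ξ ∈ net.limitSet → (∀ i, lowerBound ξ i < upperBound ξ i) →
      (interior (net.loadSet ξ)).Nonempty → ξ ∈ net.regularLimits f := by
  choose! Y W hW hYW hYW' using net.exists_dependency
  -- The limits avoid the relations for every index set and every choice of upper or lower limits.
  -- This excludes those dependencies in which the load does not occur.
  obtain ⟨ξ, hξU, hξ⟩ := exists_mem_open_forall_ne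
    (Finset.univ.filter fun p : Finset (Fin nG ⊕ Fin nE) × Finset (Fin nG ⊕ Fin nE) =>
      W p.1 ≠ 0)
    (fun p => (dotProductBilin ℝ ℝ (W p.1)).comp (boundSelection p.2))
    (fun _ => LinearMap.continuous_of_finiteDimensional _) 0 hU hne (fun p hp h0 => by
      refine (Finset.mem_filter.1 hp).2 ?_
      rw [← dotProduct_self_eq_zero]
      -- With upper and lower limits both equal to `W p.1`, every selection returns `W p.1`, and the
      -- functional takes the value `W p.1 ⬝ᵥ W p.1`.
      have := LinearMap.congr_fun h0 (limitsOf (W p.1) (W p.1))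
      have e : boundSelection p.2 (limitsOf (W p.1) (W p.1)) = W p.1 := by
        ext i
        simp [boundSelection_apply]
      rw [LinearMap.comp_apply, e] at this
      exact this)
  refine ⟨ξ, hξU, fun hlim hbd hint => ?_⟩
  have hcl := (convex_loadSet (net := net) ξ).closure_interior_eq_closure_of_nonempty_interior hint
  refine ⟨hlim, hcl, fun l hl => ?_⟩
  have hl' : l ∈ closure (interior (net.loadSet ξ)) := hcl ▸ subset_closure hl
  refine closure_minimal (fun l₀ hl₀ => ?_) isClosed_closure hl'
  rw [mem_closure_iff]
  intro V hV hl₀V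
  -- The limits being fixed, the load avoids the relations in which it does occur.
  obtain ⟨l₁, ⟨hl₁V, hl₁⟩, hgen⟩ := exists_mem_open_forall_ne
    (Finset.univ.filter fun p : Finset (Fin nG ⊕ Fin nE) × Finset (Fin nG ⊕ Fin nE) =>
      (fun j => Y p.1 (Sum.inl j)) ≠ 0)
    (fun p => dotProductBilin ℝ ℝ fun j => Y p.1 (Sum.inl j))
    (fun _ => LinearMap.continuous_of_finiteDimensional _)
    (fun p => W p.1 ⬝ᵥ boundSelection p.2 ξ)
    (hV.inter isOpen_interior) ⟨l₀, hl₀V, hl₀⟩ (fun p hp h0 => by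
      refine (Finset.mem_filter.1 hp).2 ?_
      rw [← dotProduct_self_eq_zero]
      exact LinearMap.congr_fun h0 _)
  have hl₁' := interior_subset hl₁
  refine ⟨l₁, hl₁V, hl₁', ?_⟩
  obtain ⟨θ, hθ⟩ := exists_angleOptimal hl₁' f
  refine ⟨net.generation θ, θ, isOptimal_iff.2 ⟨rfl, hθ⟩, ?_⟩
  obtain ⟨y, w, hyw, -⟩ := AngleOptimal.exists_angleKKT hθ
  have hlow := (card_support_of_mem_costSet hf hlim hl₁' hθ hyw).trans
    (Nat.add_le_add_right (Finset.card_le_card (AngleKKT.support_subset hyw)) 1)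
  rw [bindingCount_eq, Finset.filter_eq_empty_iff.2 fun {i} _ => (hbd i).ne, Finset.card_empty,
    add_zero]
  by_contra hcon
  -- At least `nG - 1` indices are active by the choice of cost. Any other count than `nG - 1` thus
  -- provides `nG` active indices, whose dependency is one of the excluded relations.
  obtain ⟨T, hTsub, hT⟩ := Finset.exists_subset_card_eq
    (show nG ≤ (net.activeSet ξ θ).card by omega)
  set σ := Finset.univ.filter fun i => (net.angleInequalities *ᵥ θ) i = upperBound ξ i with hσ
  have hdep := dependency_apply (hYW T hT) hθ.1
  have hWσ : W T ⬝ᵥ (net.angleInequalities *ᵥ θ) = W T ⬝ᵥ boundSelection σ ξ := by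
    refine Finset.sum_congr rfl fun i _ => ?_
    by_cases hi : i ∈ T
    · rw [boundSelection_apply]
      split_ifs with hiσ
      · rw [(Finset.mem_filter.1 hiσ).2]
      · rw [(mem_activeSet.1 (hTsub hi)).resolve_left fun h => hiσ (by simp [hσ, h])]
    · rw [hW T hT i hi, zero_mul, zero_mul]
  rw [hWσ] at hdep
  by_cases hY : (fun j => Y T (Sum.inl j)) = 0
  · rw [hY, zero_dotProduct] at hdep
    exact hξ (T, σ) (Finset.mem_filter.2 ⟨Finset.mem_univ _, hYW' T hT hY⟩) hdep.symm
  · exact hgen (T, σ) (Finset.mem_filter.2 ⟨Finset.mem_univ _, hY⟩) hdep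

/-! ### Realizing admissible sets -/

/-- For a generic cost vector every admissible pair occurs at some limits and load. -/
theorem GenericCost.exists_strictSolution [NeZero nL] (h : net.GenericCost f)
    (hS : net.Admissible SG SB) :
    ∃ ξ l θ y w, net.StrictSolution f ξ l θ SG SB y w ∧ (∀ j, 0 < l j) ∧
      ∀ i, 0 < sMin ξ i := by
  obtain ⟨y, w, hst, hsupp⟩ := h.exists_multipliers (by rw [Finset.card_disjSum]; exact hS.1)
    (net.independent_iff.1 hS.2)
  -- Each generator injects `nL` and each load draws `nG`, which balances and keeps all loads
  -- positive.
  obtain ⟨θ', hθ'⟩ := net.exists_laplacian_mulVec_eq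
    (b := Sum.elim (fun _ => (nL : ℝ)) fun _ => -(nG : ℝ)) (by simp [mul_comm])
  set θ := θ' - fun _ => θ' net.slack with hθ
  have hL : net.laplacian *ᵥ θ = Sum.elim (fun _ => (nL : ℝ)) fun _ => -(nG : ℝ) := by
    rw [hθ, Matrix.mulVec_sub, laplacian_mulVec_const, sub_zero, hθ']
  set a := net.angleInequalities *ᵥ θ with ha
  -- The limit selected by the sign of the multiplier is made binding and all others are slack.
  -- Generations equal `nL ≥ 1`, so the margin `1 / 2` keeps the lower generation limits positive.
  set ξ : Limits nG nE := limitsOf (fun i => if w i < 0 then a i else a i - 1 / 2)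
    (fun i => if 0 < w i then a i else a i + 1) with hξ
  have hlo : ∀ i, lowerBound ξ i = if w i < 0 then a i else a i - 1 / 2 := fun i => by
    rw [hξ, lowerBound_limitsOf]
  have hhi : ∀ i, upperBound ξ i = if 0 < w i then a i else a i + 1 := fun i => by
    rw [hξ, upperBound_limitsOf]
  have hnL : (1 : ℝ) ≤ nL := by exact_mod_cast Nat.one_le_iff_ne_zero.2 (NeZero.ne nL)
  refine ⟨ξ, fun _ => nG, θ, y, w, ⟨⟨?_, fun i => ?_, fun i => ?_⟩,
    ⟨hst, fun i hi => ?_, fun i hi => ?_⟩, hsupp, ?_, fun i _ => ?_, hS⟩, fun _ => ?_, fun i => ?_⟩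
  · ext (j | k)
    · rw [angleEqualities_mulVec_inl, hL]
      rfl
    · rw [angleEqualities_mulVec_inr, hθ]
      simp [equalityTarget]
  · rw [hlo]
    split_ifs <;> linarith
  · rw [hhi]
    split_ifs <;> linarith
  · rw [hhi, if_pos hi]
  · rw [hlo, if_pos hi]
  · ext i
    rw [mem_activeSet, ← hsupp i, hlo, hhi]
    rcases lt_trichotomy (w i) 0 with hw | hw | hw
    · simp [hw, hw.ne, ← ha]
    · simp only [hw, lt_irrefl, if_false, ne_eq, not_true_eq_false, ← ha, iff_false, not_or]
      constructor <;> intro <;> linarith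
    · simp [hw, hw.ne', ← ha]
  · rw [hlo, hhi]
    split_ifs <;> linarith
  · exact Nat.cast_pos.2 (Nat.pos_of_ne_zero (NeZero.ne nG))
  · have e : a (Sum.inl i) = nL := by
      rw [ha, angleInequalities_mulVec_inl, hL]
      rfl
    have := hlo (Sum.inl i)
    change sMin ξ i = _ at this
    rw [this, e]
    split_ifs <;> linarith

/-- The strict solution persists on an open set of limits. Regular limits exist there, so the set
meets `R`. Strict positivity of the lower generation limits keeps nearby limits in `limitSet`. -/
theorem StrictSolution.exists_mem_of_dense (h : net.StrictSolution f ξ l θ SG SB y w)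
    (hf : f ∈ net.costSet) (hl : ∀ j, 0 < l j) (hmin : ∀ i, 0 < sMin ξ i)
    {R : Set (Limits nG nE)} (hR : net.regularLimits f ⊆ closure R) :
    ∃ ξ' ∈ R, ∃ θ', net.StrictSolution f ξ' l θ' SG SB y w := by
  set σ := Finset.univ.filter (0 < w ·) with hσ
  have hpos : ∀ᶠ ξ' : Limits nG nE in 𝓝 ξ, ∀ i, 0 < sMin ξ' i := eventually_all.2 fun i =>
    ((continuous_lowerBound (Sum.inl i)).tendsto ξ).eventually (lt_mem_nhds (hmin i))
  have hpos' : ∀ᶠ l' in 𝓝 l, ∀ j, 0 < l' j := eventually_all.2 fun j =>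
    ((continuous_apply j).tendsto l).eventually (lt_mem_nhds (hl j))
  have hev := h.eventually
  rw [nhds_prod_eq] at hev
  obtain ⟨P, hP, Q, hQ, hPQ⟩ := Filter.eventually_prod_iff.1 hev
  obtain ⟨U, hU, hUo, hξU⟩ := eventually_nhds_iff.1 (hP.and hpos)
  obtain ⟨ξ₁, hξ₁U, hξ₁⟩ := net.exists_mem_regularLimits hf hUo ⟨ξ, hξU⟩
  have h₁ := hPQ (hU ξ₁ hξ₁U).1 hQ.self_of_nhds
  -- Persistence under changes of the load makes the load set a neighbourhood of `l`, so it has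
  -- interior points.
  have hreg : ξ₁ ∈ net.regularLimits f := by
    refine hξ₁ ⟨fun i => ((hU ξ₁ hξ₁U).2 i).le, l, hl, _, _,
      feasible_iff.2 ⟨rfl, h₁.1.feasible⟩⟩ h₁.2 ⟨l, mem_interior_iff_mem_nhds.2 ?_⟩
    filter_upwards [hQ, hpos'] with l' hl' hp
    exact mem_loadSet_iff.2 ⟨hp, _, (hPQ (hU ξ₁ hξ₁U).1 hl').1.feasible⟩
  obtain ⟨ξ₂, hξ₂U, hξ₂⟩ := mem_closure_iff.1 (hR hreg) U hUo hξ₁U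
  exact ⟨ξ₂, hξ₂, _, (hPQ (hU ξ₂ hξ₂U).1 hQ.self_of_nhds).1⟩

end Network

end DCOPF

/-! ### The main theorem -/

theorem theorem2 {nG nL nE : ℕ} [NeZero nG] [NeZero nL] (net : DCOPF.Network nG nL nE)
    (Ω : (Fin nG → ℝ) → Set (DCOPF.Limits nG nE))
    (hΩ : ∀ f ∈ net.costSet, Ω f ⊆ net.regularLimits f ∧ net.regularLimits f ⊆ closure (Ω f)) :
    {J | ∃ f ∈ net.costSet, ∃ ξ ∈ Ω f, ∃ l ∈ net.genericLoads ξ f, J = net.jacobian f ξ l} =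
      {J | ∃ SG SB, net.Admissible SG SB ∧ J = net.bindingJacobian SG SB} ∧
    (∀ f ∈ net.costSet, ∀ ξ ∈ Ω f, ∀ l ∈ net.genericLoads ξ f,
      DifferentiableAt ℝ (net.opf f ξ) l ∧
      ∀ s θ, net.IsOptimal f ξ l s θ →
        net.Admissible (net.bindingGens ξ s) (net.bindingBranches ξ θ) ∧
        net.jacobian f ξ l = net.bindingJacobian (net.bindingGens ξ s) (net.bindingBranches ξ θ)) ∧
    (∀ SG SB, net.Admissible SG SB →
      net.bindingMatrix SG SB * net.bindingInverse SG SB = 1 ∧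
      net.bindingInverse SG SB * net.bindingMatrix SG SB = 1 ∧
      ∃ f ∈ net.costSet, ∃ ξ ∈ Ω f, ∃ l ∈ net.genericLoads ξ f, ∃ s θ,
        net.IsOptimal f ξ l s θ ∧ net.bindingGens ξ s = SG ∧ net.bindingBranches ξ θ = SB) := by
  have part2 : ∀ f ∈ net.costSet, ∀ ξ ∈ Ω f, ∀ l ∈ net.genericLoads ξ f,
      DifferentiableAt ℝ (net.opf f ξ) l ∧
      ∀ s θ, net.IsOptimal f ξ l s θ →
        net.Admissible (net.bindingGens ξ s) (net.bindingBranches ξ θ) ∧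
        net.jacobian f ξ l
          = net.bindingJacobian (net.bindingGens ξ s) (net.bindingBranches ξ θ) := by
    intro f hf ξ hξ l hl
    have hlim := ((hΩ f hf).1 hξ).1
    obtain ⟨θ, SG, SB, y, w, h⟩ := DCOPF.Network.exists_strictSolution hf hlim hl
    have hder := h.hasFDerivAt_opf hf hlim hl.1.1
    refine ⟨hder.differentiableAt, fun s θ' hopt => ?_⟩
    obtain ⟨rfl, hθ'⟩ := DCOPF.Network.isOptimal_iff.1 hopt
    -- Uniqueness of the optimum identifies the given solution with the strict one.
    obtain rfl := DCOPF.Network.AngleOptimal.eq_of_mem_costSet hf hlim hl.1 h.angleOptimal hθ'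
    rw [h.bindingGens_eq, h.bindingBranches_eq]
    exact ⟨h.admissible, DCOPF.Network.jacobian_eq_of_hasFDerivAt hder⟩
  have part3 : ∀ SG SB, net.Admissible SG SB →
      ∃ f ∈ net.costSet, ∃ ξ ∈ Ω f, ∃ l ∈ net.genericLoads ξ f, ∃ s θ,
        net.IsOptimal f ξ l s θ ∧ net.bindingGens ξ s = SG ∧ net.bindingBranches ξ θ = SB := by
    intro SG SB hS
    obtain ⟨f, hf₀, hgen⟩ := net.exists_genericCost
    have hf := hgen.mem_costSet hf₀
    obtain ⟨ξ, l, θ, y, w, h, hl, hmin⟩ := hgen.exists_strictSolution hS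
    obtain ⟨ξ', hξ', θ', h'⟩ := h.exists_mem_of_dense hf hl hmin (hΩ f hf).2
    exact ⟨f, hf, ξ', hξ', l, h'.mem_genericLoads hl, _, θ',
      DCOPF.Network.isOptimal_iff.2 ⟨rfl, h'.angleOptimal⟩, h'.bindingGens_eq,
      h'.bindingBranches_eq⟩
  refine ⟨Set.ext fun J => ⟨?_, ?_⟩, part2, fun SG SB hS =>
    ⟨hS.inverse_spec.1, hS.inverse_spec.2, part3 SG SB hS⟩⟩
  · rintro ⟨f, hf, ξ, hξ, l, hl, rfl⟩
    obtain ⟨s, θ, hopt, -⟩ := hl.2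
    exact ⟨_, _, (part2 f hf ξ hξ l hl).2 s θ hopt⟩
  · rintro ⟨SG, SB, hS, rfl⟩
    obtain ⟨f, hf, ξ, hξ, l, hl, s, θ, hopt, rfl, rfl⟩ := part3 SG SB hS
    exact ⟨f, hf, ξ, hξ, l, hl, ((part2 f hf ξ hξ l hl).2 s θ hopt).2.symm⟩
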